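/- For $q\in(0,1)$ and $\nu>0$ let $(a;q)_0=1$, $(a;q)_n=\prod_{k=1}^{n}(1-aq^{k-1})$, $(a;q)_\infty=\prod_{k\ge1}(1-aq^{k-1})$, let $$J_\nu^{(3)}(z;q)=\frac{(q^{\nu+1};q)_\infty}{(q;q)_\infty}\sum_{n\ge0}\frac{(-1)^n z^{2n+\nu}}{(q;q)_n(q^{\nu+1};q)_n}\,q^{\frac12 n(n+1)}$$ be the Hahn--Exton $q$-Bessel function, and let $c_\nu(q)=(q;q)_\infty/(q^{\nu+1};q)_\infty$. Let $f_\nu^{(3)}(z;q)=\bigl(c_\nu(q)J_\nu^{(3)}(z;q)\bigr)^{1/\nu}$, that is, $z\,\bigl(c_\nu(q)z^{-\nu}J_\nu^{(3)}(z;q)\bigr)^{1/\nu}$ with the analytic branch of the power that equals $1$ at $z=0$ (continued along rays from the origin). For a function $f$ with $f(0)=f'(0)-1=0$, the radius of starlikeness $r^*(f)$ is the supremum of all $r>0$ such that $f$ is analytic in $|z|<r$ and $\operatorname{Re}\bigl(zf'(z)/f(z)\bigr)>0$ for all $0<|z|<r$. Theorem. Let $\nu>0$. (1) For every $q\in(0,1)$,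 the radius of starlikeness $r^*=r^*\bigl(f_\nu^{(3)}(\cdot;q)\bigr)$ is the smallest positive root of the equation $r\cdot dJ_\nu^{(3)}(r;q)/dr=0$, and $L_\nu(q)<(r^*)^2<U_\nu(q)$, where $$L_\nu(q)=\frac{\nu(1-q)(1-q^{\nu+1})}{q(\nu+2)},\qquad U_\nu(q)=\frac{\nu(\nu+2)(1-q^2)(1-q^{\nu+1})(1-q^{\nu+2})}{q\left((1+q)(1-q^{\nu+2})(\nu+2)^2-2\nu(\nu+4)q(1-q^{\nu+1})\right)}.$$ (2) As $q\nearrow1$, $$\frac{L_\nu(q)}{(1-q)^2}\to\frac{\nu(\nu+1)}{\nu+2},\qquad \frac{U_\nu(q)}{(1-q)^2}\to\frac{\nu(\nu+1)(\nu+2)^2}{\nu^2+8\nu+8}.$$ Moreover, the derivative $J_\nu'$ of the classical Bessel function of the first kind $J_\nu$ has a smallest positive zero $j'_{\nu,1}$, one has $(r^*)^2/(1-q)^2\to(j'_{\nu,1})^2/4$ as $q\nearrow1$, and $$\frac{4\nu(\nu+1)}{\nu+2}<\bigl(j'_{\nu,1}\bigr)^2<\frac{4\nu(\nu+1)(\nu+2)^2}{\nu^2+8\nu+8}.$$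 -/

import Mathlib

open Set Filter Topology

noncomputable section

/-- The finite `q`-shifted factorial `(a; q)_n = ∏_{k=1}^{n} (1 - a q^(k-1))`. -/
def qPoch (a q : ℝ) (n : ℕ) : ℝ := ∏ k ∈ Finset.range n, (1 - a * q ^ k)

/-- The infinite `q`-shifted factorial `(a; q)_∞ = ∏_{k ≥ 1} (1 - a q^(k-1))`. -/
def qPochInf (a q : ℝ) : ℝ := ∏' k : ℕ, (1 - a * q ^ k)

/-- The Hahn-Exton `q`-Bessel function `J_ν^{(3)}(z; q)` (principal value of `z ^ (2n + ν)`). -/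
def hahnExtonJ (ν q : ℝ) (z : ℂ) : ℂ :=
  ((qPochInf (q ^ (ν + 1)) q / qPochInf q q : ℝ) : ℂ) *
    ∑' n : ℕ, (-1) ^ n * z ^ (2 * (n : ℂ) + (ν : ℂ)) /
      ((qPoch q q n * qPoch (q ^ (ν + 1)) q n : ℝ) : ℂ) * ((q ^ (n * (n + 1) / 2) : ℝ) : ℂ)

/-- The normalizing constant `c_ν(q) = (q; q)_∞ / (q^(ν+1); q)_∞`. -/
def hahnExtonC (ν q : ℝ) : ℝ := qPochInf q q / qPochInf (q ^ (ν + 1)) q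

/-- The entire even function `z ↦ c_ν(q) z^(-ν) J_ν^{(3)}(z; q)`, whose value at `0` is `1`. -/
def hahnExtonPhi (ν q : ℝ) (z : ℂ) : ℂ :=
  if z = 0 then 1 else (hahnExtonC ν q : ℂ) * hahnExtonJ ν q z / z ^ (ν : ℂ)

/-- The logarithm of `φ` obtained by continuation along the segment from `0` to `z`, starting from
the value `0` at `0`: the integral of `φ' / φ` over that segment. -/
def radialLog (φ : ℂ → ℂ) (z : ℂ) : ℂ :=
  ∫ t in (0 : ℝ)..1, z * deriv φ ((t : ℂ) * z) / φ ((t : ℂ) * z)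

/-- `radialLog φ` is a logarithm of `φ / φ 0` where `φ` has no zero between `0` and `z`. -/
theorem exp_radialLog {φ : ℂ → ℂ} (hφ : Differentiable ℂ φ) {z : ℂ}
    (h : ∀ t ∈ Icc (0 : ℝ) 1, φ ((t : ℂ) * z) ≠ 0) :
    Complex.exp (radialLog φ z) = φ z / φ 0 := by
  have hd : Differentiable ℂ (deriv φ) := hφ.contDiff.differentiable_deriv_two
  have hline : Continuous fun t : ℝ => (t : ℂ) * z := by fun_prop
  set g : ℝ → ℂ := fun t => z * deriv φ ((t : ℂ) * z) / φ ((t : ℂ) * z) with hg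
  set U : Set ℝ := {t | φ ((t : ℂ) * z) ≠ 0} with hU
  have hUo : IsOpen U := isOpen_ne_fun (hφ.continuous.comp hline) continuous_const
  have hgc : ContinuousOn g U := by
    apply ContinuousOn.div
    · exact (continuous_const.mul (hd.continuous.comp hline)).continuousOn
    · exact (hφ.continuous.comp hline).continuousOn
    · exact fun t ht => ht
  have hG : ∀ t ∈ Icc (0 : ℝ) 1, HasDerivAt (fun s => ∫ u in (0 : ℝ)..s, g u) (g t) t := by
    intro t ht
    apply intervalIntegral.integral_hasDerivAt_right
    · apply ContinuousOn.intervalIntegrable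
      refine hgc.mono fun s hs => h s ?_
      rw [uIcc_of_le ht.1] at hs
      exact ⟨hs.1, hs.2.trans ht.2⟩
    · exact hgc.stronglyMeasurableAtFilter hUo t (h t ht)
    · exact hgc.continuousAt (hUo.mem_nhds (h t ht))
  have hP : ∀ t : ℝ, HasDerivAt (fun s : ℝ => φ ((s : ℂ) * z))
      (deriv φ ((t : ℂ) * z) * z) t := by
    intro t
    have h1 : HasDerivAt (fun s : ℝ => (s : ℂ) * z) z t := by
      simpa using (Complex.ofRealCLM.hasDerivAt (x := t)).mul_const z
    exact (hφ ((t : ℂ) * z)).hasDerivAt.comp t h1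
  have hu : ∀ t ∈ Icc (0 : ℝ) 1, HasDerivAt
      (fun s : ℝ => φ ((s : ℂ) * z) * Complex.exp (-∫ u in (0 : ℝ)..s, g u)) 0 t := by
    intro t ht
    have h2 := (hP t).mul ((hG t ht).neg.cexp)
    refine h2.congr_deriv ?_
    have hne := h t ht
    simp only [hg]
    field_simp
    ring
  have hc := constant_of_has_deriv_right_zero
    (fun t ht => (hu t ht).continuousAt.continuousWithinAt)
    (fun t ht => (hu t ⟨ht.1, ht.2.le⟩).hasDerivWithinAt) 1 (right_mem_Icc.2 zero_le_one)
  have h0 : φ 0 ≠ 0 := by simpa using h 0 (left_mem_Icc.2 zero_le_one)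
  have hr : radialLog φ z = ∫ u in (0 : ℝ)..1, g u := rfl
  simp only [Complex.ofReal_one, one_mul, Complex.ofReal_zero, zero_mul,
    intervalIntegral.integral_same, neg_zero, Complex.exp_zero, mul_one] at hc
  rw [← hr, Complex.exp_neg] at hc
  rw [← hc]
  have := Complex.exp_ne_zero (radialLog φ z)
  have hz : φ z ≠ 0 := by simpa using h 1 (right_mem_Icc.2 zero_le_one)
  field_simp

/-- The normalized function `f_ν^{(3)}(z; q) = (c_ν(q) J_ν^{(3)}(z; q))^(1/ν)`, that is
`z (c_ν(q) z^(-ν) J_ν^{(3)}(z; q))^(1/ν)` with the branch of the power that is `1` at the origin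
and is continued along rays; it is analytic near `0` with `f(0) = 0` and `f'(0) = 1`.
(The principal value of the power would be discontinuous inside the disk for large `ν`.) -/
def hahnExtonF (ν q : ℝ) (z : ℂ) : ℂ :=
  z * Complex.exp (radialLog (hahnExtonPhi ν q) z / (ν : ℂ))

/-- The radius of starlikeness of `f`, a function with `f(0) = 0` and `f'(0) = 1`: the supremum of
all `r > 0` such that `f` is analytic in the disk of radius `r` about `0` and
`Re (z f'(z) / f(z)) > 0` there. At `z = 0` the quotient has the limit `1`, so
only `z ≠ 0` is considered. -/
def starlikeRadius (f : ℂ → ℂ) : ℝ :=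
  sSup {r : ℝ | 0 < r ∧ DifferentiableOn ℂ f (Metric.ball 0 r) ∧
    ∀ z ∈ Metric.ball (0 : ℂ) r, z ≠ 0 → 0 < (z * deriv f z / f z).re}

/-- The classical Bessel function of the first kind
`J_ν(z) = ∑_{n ≥ 0} (-1)^n (z/2)^(2n+ν) / (n! Γ(n+ν+1))` (principal value of the power). -/
def besselJ (ν : ℝ) (z : ℂ) : ℂ :=
  ∑' n : ℕ, (-1) ^ n * (z / 2) ^ (2 * (n : ℂ) + (ν : ℂ)) /
    ((n.factorial * Real.Gamma (n + ν + 1) : ℝ) : ℂ)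

/-- The lower bound for the square of the radius of starlikeness of `f_ν^{(3)}(·; q)`. -/
def hahnExtonLower (ν q : ℝ) : ℝ :=
  ν * (1 - q) * (1 - q ^ (ν + 1)) / (q * (ν + 2))

/-- The upper bound for the square of the radius of starlikeness of `f_ν^{(3)}(·; q)`. -/
def hahnExtonUpper (ν q : ℝ) : ℝ :=
  ν * (ν + 2) * (1 - q ^ 2) * (1 - q ^ (ν + 1)) * (1 - q ^ (ν + 2)) /
    (q * ((1 + q) * (1 - q ^ (ν + 2)) * (ν + 2) ^ 2
      - 2 * ν * (ν + 4) * q * (1 - q ^ (ν + 1))))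

end

/-! Write c_ν z^(-ν) J_ν(z; q) = Φ(z²) with Φ(w) = ∑ (-1)^n e_n w^n and all e_n > 0. With w = z²,
the quotient z f'/f equals Ψ(w)/Φ(w), where Ψ = Φ + (2/ν) w Φ', and on the positive axis J' is a
nonvanishing factor times Ψ. Everything therefore rests on Φ having only positive zeros and on
locating the smallest zero γ of Ψ.

Hadamard factorization is avoided. Having only positive zeros is encoded as `PosRootLimit`: being a
locally uniform limit of products ∏ (1 - x_i w) with x_i > 0. Inequalities proved for the finite
products pass to the limit, and the class is closed under locally uniform limits, scaling, and F ↦ F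
+ c w F' with c > 0 (`PosRootLimit.eulerOp`).

That Φ lies in the class is `posRootLimit_hahnCoeff`. The q-difference equation of Φ is a three-term
recurrence for Φ(q^(-n) u). Started from constant values, the same recurrence produces polynomials
whose roots are positive by a sign argument, and stability of the recurrence makes them converge to
Φ after rescaling.

On |w| = r below the first zero of Φ, |Φ'/Φ| is largest at w = r, so positivity of the real part of
Ψ/Φ is decided on the positive axis; hence the radius is √γ (`starlikeRadius_eq`). The bounds on γ
are of Euler-Rayleigh type: if S₁, S₂ are the sums of the reciprocal zeros of Ψ and of their
squares, then γ² S₂ ≥ 1 and γ S₂ < S₁ (`exists_isFirstZero`), and S₁, S₂ are read off the first two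
coefficients.

For q → 1, scale w by (1 - q)². The coefficients converge, dominated uniformly in q, to those of the
Bessel function, so membership in the class passes to the limit and the smallest zeros converge
(`tendsto_isFirstZero`). -/

/-! ### Inequalities for polynomials with positive roots -/

/-- The polynomial with value `1` at `0` and reciprocal roots `x i`. -/
def rootProd {n : ℕ} (x : Fin n → ℝ) (w : ℂ) : ℂ := ∏ i, (1 - (x i : ℂ) * w)

theorem rootProd_ofReal {n : ℕ} (x : Fin n → ℝ) (r : ℝ) :
    rootProd x r = ((∏ i, (1 - x i * r) : ℝ) : ℂ) := by
  simp [rootProd]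

theorem rootProd_zero {n : ℕ} (x : Fin n → ℝ) : rootProd x 0 = 1 := by
  simp [rootProd]

theorem hasDerivAt_rootProd {n : ℕ} (x : Fin n → ℝ) (w : ℂ) :
    HasDerivAt (rootProd x)
      (-∑ i, (x i : ℂ) * ∏ j ∈ Finset.univ.erase i, (1 - (x j : ℂ) * w)) w := by
  have h : ∀ i ∈ (Finset.univ : Finset (Fin n)),
      HasDerivAt (fun w : ℂ => 1 - (x i : ℂ) * w) (-(x i : ℂ)) w := by
    intro i _
    simpa using ((hasDerivAt_id w).const_mul (x i : ℂ)).const_sub 1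
  refine (HasDerivAt.fun_finsetProd h).congr_deriv ?_
  rw [← Finset.sum_neg_distrib]
  refine Finset.sum_congr rfl fun i _ => ?_
  rw [smul_eq_mul]
  ring

theorem deriv_rootProd {n : ℕ} (x : Fin n → ℝ) :
    deriv (rootProd x) =
      fun w => -∑ i, (x i : ℂ) * ∏ j ∈ Finset.univ.erase i, (1 - (x j : ℂ) * w) :=
  funext fun w => (hasDerivAt_rootProd x w).deriv

theorem differentiable_rootProd {n : ℕ} (x : Fin n → ℝ) : Differentiable ℂ (rootProd x) :=
  fun w => (hasDerivAt_rootProd x w).differentiableAt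

theorem deriv_rootProd_zero {n : ℕ} (x : Fin n → ℝ) :
    deriv (rootProd x) 0 = ((-∑ i, x i : ℝ) : ℂ) := by
  simp [deriv_rootProd]

theorem deriv_rootProd_ofReal {n : ℕ} (x : Fin n → ℝ) (r : ℝ) :
    deriv (rootProd x) r =
      ((-∑ i, x i * ∏ j ∈ Finset.univ.erase i, (1 - x j * r) : ℝ) : ℂ) := by
  simp [deriv_rootProd]

theorem deriv_deriv_rootProd_zero {n : ℕ} (x : Fin n → ℝ) :
    deriv (deriv (rootProd x)) 0 = (((∑ i, x i) ^ 2 - ∑ i, x i ^ 2 : ℝ) : ℂ) := by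
  rw [deriv_rootProd]
  have h : ∀ i ∈ (Finset.univ : Finset (Fin n)), HasDerivAt
      (fun w : ℂ => (x i : ℂ) * ∏ j ∈ Finset.univ.erase i, (1 - (x j : ℂ) * w))
      ((x i : ℂ) * ((x i : ℂ) - ∑ j, (x j : ℂ))) 0 := by
    intro i _
    have h1 : ∀ j ∈ (Finset.univ.erase i : Finset (Fin n)),
        HasDerivAt (fun w : ℂ => 1 - (x j : ℂ) * w) (-(x j : ℂ)) 0 := by
      intro j _
      simpa using ((hasDerivAt_id (0 : ℂ)).const_mul (x j : ℂ)).const_sub 1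
    refine ((HasDerivAt.fun_finsetProd h1).const_mul (x i : ℂ)).congr_deriv ?_
    congr 1
    rw [← Finset.add_sum_erase Finset.univ (fun j => (x j : ℂ)) (Finset.mem_univ i)]
    simp
  rw [((HasDerivAt.fun_sum h).fun_neg).deriv]
  push_cast
  rw [← Finset.sum_neg_distrib, sq, Finset.sum_mul, ← Finset.sum_sub_distrib]
  refine Finset.sum_congr rfl fun i _ => ?_
  ring

theorem one_sub_mul_le_norm {x r : ℝ} {w : ℂ} (hx : 0 ≤ x) (hw : ‖w‖ ≤ r) :
    1 - x * r ≤ ‖1 - (x : ℂ) * w‖ := by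
  have h1 : ‖(1 : ℂ)‖ - ‖(x : ℂ) * w‖ ≤ ‖1 - (x : ℂ) * w‖ := norm_sub_norm_le _ _
  rw [norm_one, norm_mul, Complex.norm_real, Real.norm_of_nonneg hx] at h1
  nlinarith

theorem prod_le_norm_rootProd {n : ℕ} {x : Fin n → ℝ} (hx : ∀ i, 0 < x i) {r : ℝ} {w : ℂ}
    (hw : ‖w‖ ≤ r) (h : ∀ i, x i * r < 1) : ∏ i, (1 - x i * r) ≤ ‖rootProd x w‖ := by
  rw [rootProd, norm_prod]
  exact Finset.prod_le_prod (fun i _ => by linarith [h i])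
    fun i _ => one_sub_mul_le_norm (hx i).le hw

/-- This is |P'/P|(w) ≤ ∑ x_i/(1 - x_i r) = -P'(r)/P(r), termwise from |1 - x w| ≥ 1 - x r.
Denominators are cleared so that the inequality survives passage to the limit. -/
theorem norm_deriv_rootProd_mul_le {n : ℕ} {x : Fin n → ℝ} (hx : ∀ i, 0 < x i) {r : ℝ} {w : ℂ}
    (hw : ‖w‖ ≤ r) (h : ∀ i, x i * r < 1) :
    ‖deriv (rootProd x) w‖ * ∏ i, (1 - x i * r) ≤
      (∑ i, x i * ∏ j ∈ Finset.univ.erase i, (1 - x j * r)) * ‖rootProd x w‖ := by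
  have hP : 0 ≤ ∏ i, (1 - x i * r) := Finset.prod_nonneg fun i _ => by linarith [h i]
  have h1 : ‖deriv (rootProd x) w‖ ≤
      ∑ i, x i * ‖∏ j ∈ Finset.univ.erase i, (1 - (x j : ℂ) * w)‖ := by
    rw [deriv_rootProd, norm_neg]
    refine (norm_sum_le _ _).trans (Finset.sum_le_sum fun i _ => ?_)
    rw [norm_mul, Complex.norm_real, Real.norm_of_nonneg (hx i).le]
  refine (mul_le_mul_of_nonneg_right h1 hP).trans ?_
  rw [Finset.sum_mul, Finset.sum_mul]
  refine Finset.sum_le_sum fun i _ => ?_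
  rw [mul_assoc, mul_assoc]
  refine mul_le_mul_of_nonneg_left ?_ (hx i).le
  have hA : 0 ≤ ∏ j ∈ Finset.univ.erase i, (1 - x j * r) :=
    Finset.prod_nonneg fun i _ => by linarith [h i]
  rw [rootProd, ← Finset.mul_prod_erase Finset.univ _ (Finset.mem_univ i),
    ← Finset.mul_prod_erase Finset.univ (fun j => 1 - (x j : ℂ) * w) (Finset.mem_univ i), norm_mul]
  have := mul_le_mul_of_nonneg_left (one_sub_mul_le_norm (hx i).le hw)
    (mul_nonneg (norm_nonneg (∏ j ∈ Finset.univ.erase i, (1 - (x j : ℂ) * w))) hA)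
  nlinarith

theorem norm_one_sub_le_exp {x R : ℝ} {w : ℂ} (hx : 0 ≤ x) (hw : ‖w‖ ≤ R) :
    ‖1 - (x : ℂ) * w‖ ≤ Real.exp (x * R) := by
  have h1 : ‖1 - (x : ℂ) * w‖ ≤ ‖(1 : ℂ)‖ + ‖(x : ℂ) * w‖ := norm_sub_le _ _
  rw [norm_one, norm_mul, Complex.norm_real, Real.norm_of_nonneg hx] at h1
  have := Real.add_one_le_exp (x * R)
  nlinarith

theorem norm_prod_erase_le {n : ℕ} {x : Fin n → ℝ} (hx : ∀ i, 0 < x i) {R : ℝ} (hR : 0 ≤ R)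
    {w : ℂ} (hw : ‖w‖ ≤ R) (i : Fin n) :
    ‖∏ j ∈ Finset.univ.erase i, (1 - (x j : ℂ) * w)‖ ≤ Real.exp ((∑ j, x j) * R) := by
  rw [norm_prod, Finset.sum_mul]
  refine (Finset.prod_le_prod (fun _ _ => norm_nonneg _)
    fun j _ => norm_one_sub_le_exp (hx j).le hw).trans ?_
  rw [← Real.exp_sum, Real.exp_le_exp]
  exact Finset.sum_le_sum_of_subset_of_nonneg (Finset.erase_subset _ _)
    fun j _ _ => mul_nonneg (hx j).le hR

/-- A linear differential expression which vanishes when all `x i` are equal to `M`. -/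
theorem norm_deriv_rootProd_add_le {n : ℕ} {x : Fin n → ℝ} (hx : ∀ i, 0 < x i) {R : ℝ}
    (hR : 0 ≤ R) {w : ℂ} (hw : ‖w‖ ≤ R) (M : ℝ) :
    ‖deriv (rootProd x) w * (1 - M * w) + (∑ i, x i : ℝ) * rootProd x w‖ ≤
      (∑ i, x i * |M - x i|) * (R * Real.exp ((∑ j, x j) * R)) := by
  have h1 : deriv (rootProd x) w * (1 - M * w) + (∑ i, x i : ℝ) * rootProd x w =
      ∑ i, (x i * (M - x i) : ℝ) * (w * ∏ j ∈ Finset.univ.erase i, (1 - (x j : ℂ) * w)) := by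
    rw [deriv_rootProd]
    push_cast
    rw [neg_mul, Finset.sum_mul, Finset.sum_mul, ← Finset.sum_neg_distrib,
      ← Finset.sum_add_distrib]
    refine Finset.sum_congr rfl fun i _ => ?_
    rw [rootProd, ← Finset.mul_prod_erase Finset.univ _ (Finset.mem_univ i)]
    ring
  rw [h1, Finset.sum_mul]
  refine (norm_sum_le _ _).trans (Finset.sum_le_sum fun i _ => ?_)
  rw [norm_mul, norm_mul, Complex.norm_real, Real.norm_eq_abs, abs_mul, abs_of_pos (hx i)]
  refine mul_le_mul_of_nonneg_left ?_ (mul_nonneg (hx i).le (abs_nonneg _))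
  exact mul_le_mul hw (norm_prod_erase_le hx hR hw i) (norm_nonneg _) hR

theorem one_sub_sum_le_prod {ι : Type*} (s : Finset ι) (y : ι → ℝ) (h0 : ∀ i, 0 ≤ y i)
    (h1 : ∀ i, y i ≤ 1) : 1 - ∑ i ∈ s, y i ≤ ∏ i ∈ s, (1 - y i) := by
  classical
  have h : (∏ i ∈ s, (1 - y i)) ≤ 1 ∧ 0 ≤ ∏ i ∈ s, (1 - y i) ∧
      1 - ∑ i ∈ s, y i ≤ ∏ i ∈ s, (1 - y i) := by
    induction s using Finset.induction_on with
    | empty => simp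
    | insert a s ha ih =>
      rw [Finset.prod_insert ha, Finset.sum_insert ha]
      obtain ⟨h2, h3, h4⟩ := ih
      have := h0 a
      have := h1 a
      refine ⟨?_, ?_, ?_⟩ <;> nlinarith
  exact h.2.2

/-- Pairing r with -r gives P(r) P(-r) = ∏ (1 - x_i² r²), to which the Weierstrass product
inequality applies. A zero at r then forces the sum of squares to be large. -/
theorem one_sub_sq_le_rootProd_mul {n : ℕ} (x : Fin n → ℝ) {r : ℝ}
    (h : r ^ 2 * ∑ i, x i ^ 2 ≤ 1) :
    1 - r ^ 2 * ∑ i, x i ^ 2 ≤ (∏ i, (1 - x i * r)) * ∏ i, (1 - x i * (-r)) := by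
  rw [← Finset.prod_mul_distrib, Finset.mul_sum]
  have h1 := one_sub_sum_le_prod Finset.univ (fun i => r ^ 2 * x i ^ 2) (fun i => by positivity)
    (fun i => ?_)
  · refine h1.trans (le_of_eq (Finset.prod_congr rfl fun i _ => ?_))
    ring
  · refine le_trans ?_ h
    exact mul_le_mul_of_nonneg_left
      (Finset.single_le_sum (f := fun i => x i ^ 2) (fun j _ => sq_nonneg _) (Finset.mem_univ i))
      (sq_nonneg r)

/-- For y = x r ≤ 1 - δ, one has 1 / (1 - y) = 1 + y / (1 - y) ≤ 1 + y / δ ≤ exp (y / δ); multiply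
over the roots. -/
theorem exp_le_prod {n : ℕ} (x : Fin n → ℝ) (hx : ∀ i, 0 < x i) {r δ : ℝ} (hr : 0 ≤ r)
    (hδ : 0 < δ) (h : ∀ i, δ ≤ 1 - x i * r) :
    Real.exp (-((∑ i, x i) * (r / δ))) ≤ ∏ i, (1 - x i * r) := by
  rw [Finset.sum_mul, ← Finset.sum_neg_distrib, Real.exp_sum]
  refine Finset.prod_le_prod (fun _ _ => (Real.exp_pos _).le) fun i _ => ?_
  have h1 : 0 < 1 - x i * r := hδ.trans_le (h i)
  have h2 := Real.add_one_le_exp (x i * (r / δ))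
  rw [Real.exp_neg, inv_le_comm₀ (Real.exp_pos _) h1]
  refine le_trans ?_ h2
  rw [inv_le_iff_one_le_mul₀ h1]
  have h3 : x i * r ≤ (x i * r / δ) * (1 - x i * r) := by
    rw [div_mul_eq_mul_div, le_div_iff₀ hδ]
    exact mul_le_mul_of_nonneg_left (h i) (mul_nonneg (hx i).le hr)
  have h4 : x i * (r / δ) = x i * r / δ := by ring
  rw [h4]
  nlinarith

/-! ### Locally uniform limits of polynomials with positive roots -/

/-- Locally uniform limits of polynomials with value `1` at `0` and positive roots. -/
def PosRootLimit (F : ℂ → ℂ) : Prop :=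
  ∀ R ε : ℝ, 0 < ε → ∃ n, ∃ x : Fin n → ℝ, (∀ i, 0 < x i) ∧
    ∀ w, ‖w‖ ≤ R → ‖F w - rootProd x w‖ ≤ ε

/-- A sequence of polynomials with positive roots that converges to `F`. -/
structure RootApprox (F : ℂ → ℂ) where
  deg : ℕ → ℕ
  x : ∀ N, Fin (deg N) → ℝ
  pos : ∀ N i, 0 < x N i
  lim : TendstoLocallyUniformly (fun N => rootProd (x N)) F atTop

theorem PosRootLimit.exists_approx {F : ℂ → ℂ} (h : PosRootLimit F) : Nonempty (RootApprox F) := by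
  choose n x hx hF using fun N : ℕ => h N (1 / (N + 1)) (by positivity)
  refine ⟨⟨n, x, hx, ?_⟩⟩
  rw [tendstoLocallyUniformly_iff_forall_isCompact]
  intro K hK
  rw [Metric.tendstoUniformlyOn_iff]
  intro ε hε
  obtain ⟨R, hR⟩ := hK.isBounded.subset_closedBall 0
  obtain ⟨N₀, hN₀⟩ := exists_nat_one_div_lt hε
  filter_upwards [eventually_ge_atTop N₀, eventually_ge_atTop ⌈R⌉₊] with N hN hNR w hw
  have hw' : ‖w‖ ≤ N := by
    have h1 := hR hw
    rw [Metric.mem_closedBall, dist_zero_right] at h1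
    exact h1.trans ((Nat.le_ceil R).trans (by exact_mod_cast hNR))
  rw [dist_eq_norm]
  refine (hF N w hw').trans_lt (lt_of_le_of_lt ?_ hN₀)
  have : (N₀ : ℝ) ≤ N := by exact_mod_cast hN
  gcongr

theorem posRootLimit_of_tendsto {ι : Type*} {l : Filter ι} [l.NeBot] {G : ι → ℂ → ℂ} {F : ℂ → ℂ}
    (hG : ∀ᶠ i in l, PosRootLimit (G i)) (h : TendstoLocallyUniformly G F l) :
    PosRootLimit F := by
  intro R ε hε
  rw [tendstoLocallyUniformly_iff_forall_isCompact] at h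
  have h1 := Metric.tendstoUniformlyOn_iff.1 (h _ (isCompact_closedBall 0 R)) (ε / 2) (half_pos hε)
  obtain ⟨i, hi, hiG⟩ := (h1.and hG).exists
  obtain ⟨n, x, hx, hxF⟩ := hiG R (ε / 2) (half_pos hε)
  refine ⟨n, x, hx, fun w hw => ?_⟩
  have h2 := hi w (by simpa using hw)
  rw [dist_eq_norm] at h2
  have h3 := hxF w hw
  have h4 : F w - rootProd x w = (F w - G i w) + (G i w - rootProd x w) := by ring
  rw [h4]
  exact (norm_add_le _ _).trans (by linarith)

theorem posRootLimit_rootProd {n : ℕ} {x : Fin n → ℝ} (hx : ∀ i, 0 < x i) :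
    PosRootLimit (rootProd x) :=
  fun _ _ hε => ⟨n, x, hx, fun w _ => by simpa using hε.le⟩

/-! ### Sums over reciprocal zeros and Euler-Rayleigh inequalities -/

/-- The sum of the reciprocal zeros. -/
noncomputable def zeroSum (F : ℂ → ℂ) : ℝ := -(deriv F 0).re

/-- The sum of the squares of the reciprocal zeros. -/
noncomputable def zeroSqSum (F : ℂ → ℂ) : ℝ := (deriv F 0).re ^ 2 - (deriv (deriv F) 0).re

theorem TendstoLocallyUniformly.complex_deriv {ι : Type*} {l : Filter ι} {G : ι → ℂ → ℂ}
    {F : ℂ → ℂ} (h : TendstoLocallyUniformly G F l) (hG : ∀ i, Differentiable ℂ (G i)) :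
    TendstoLocallyUniformly (fun i => deriv (G i)) (deriv F) l := by
  rw [← tendstoLocallyUniformlyOn_univ] at h ⊢
  exact h.deriv (.of_forall fun i => (hG i).differentiableOn) isOpen_univ

theorem tendsto_of_tendstoLocallyUniformly {ι : Type*} {l : Filter ι} {G : ι → ℂ → ℂ}
    {F : ℂ → ℂ} (h : TendstoLocallyUniformly G F l) (w : ℂ) :
    Tendsto (fun i => G i w) l (𝓝 (F w)) := by
  rw [← tendstoLocallyUniformlyOn_univ] at h
  exact h.tendsto_at (mem_univ w)

namespace RootApprox

theorem differentiable {F : ℂ → ℂ} (A : RootApprox F) : Differentiable ℂ F := by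
  have h := A.lim
  rw [← tendstoLocallyUniformlyOn_univ] at h
  exact differentiableOn_univ.1 (h.differentiableOn
    (.of_forall fun N => (differentiable_rootProd _).differentiableOn) isOpen_univ)

theorem tendsto_deriv {F : ℂ → ℂ} (A : RootApprox F) (w : ℂ) :
    Tendsto (fun N => deriv (rootProd (A.x N)) w) atTop (𝓝 (deriv F w)) :=
  tendsto_of_tendstoLocallyUniformly
    (A.lim.complex_deriv fun N => differentiable_rootProd (A.x N)) w

theorem tendsto_re {F : ℂ → ℂ} (A : RootApprox F) (r : ℝ) :
    Tendsto (fun N => ∏ i, (1 - A.x N i * r)) atTop (𝓝 (F r).re) := by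
  refine ((Complex.continuous_re.tendsto _).comp
    (tendsto_of_tendstoLocallyUniformly A.lim (r : ℂ))).congr fun N => ?_
  simp only [Function.comp_apply, rootProd_ofReal, Complex.ofReal_re]

theorem ofReal_re {F : ℂ → ℂ} (A : RootApprox F) (r : ℝ) : (((F r).re : ℝ) : ℂ) = F r := by
  refine tendsto_nhds_unique ((Complex.continuous_ofReal.tendsto _).comp (A.tendsto_re r)) ?_
  refine (tendsto_of_tendstoLocallyUniformly A.lim (r : ℂ)).congr fun N => ?_
  exact rootProd_ofReal _ _

theorem tendsto_deriv_re {F : ℂ → ℂ} (A : RootApprox F) (r : ℝ) :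
    Tendsto (fun N => ∑ i, A.x N i * ∏ j ∈ Finset.univ.erase i, (1 - A.x N j * r)) atTop
      (𝓝 (-(deriv F r).re)) := by
  refine ((Complex.continuous_re.tendsto _).comp (A.tendsto_deriv r)).neg.congr fun N => ?_
  simp only [Function.comp_apply, deriv_rootProd_ofReal, Complex.ofReal_re, neg_neg]

theorem map_zero {F : ℂ → ℂ} (A : RootApprox F) : F 0 = 1 := by
  refine tendsto_nhds_unique (tendsto_of_tendstoLocallyUniformly A.lim 0) ?_
  simp [rootProd_zero]

theorem tendsto_zeroSum {F : ℂ → ℂ} (A : RootApprox F) :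
    Tendsto (fun N => ∑ i, A.x N i) atTop (𝓝 (zeroSum F)) := by
  refine ((Complex.continuous_re.tendsto _).comp (A.tendsto_deriv 0)).neg.congr fun N => ?_
  simp only [Function.comp_apply, deriv_rootProd_zero, Complex.ofReal_re, neg_neg]

theorem tendsto_zeroSqSum {F : ℂ → ℂ} (A : RootApprox F) :
    Tendsto (fun N => ∑ i, A.x N i ^ 2) atTop (𝓝 (zeroSqSum F)) := by
  have h1 := tendsto_of_tendstoLocallyUniformly
    ((A.lim.complex_deriv fun N => differentiable_rootProd (A.x N)).complex_deriv
      fun N => ((differentiable_rootProd (A.x N)).contDiff (n := 2)).differentiable_deriv_two) 0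
  have h2 := (Complex.continuous_re.tendsto _).comp h1
  have h3 := ((Complex.continuous_re.tendsto _).comp (A.tendsto_deriv 0)).pow 2
  refine (h3.sub h2).congr fun N => ?_
  simp only [Function.comp_apply, deriv_rootProd_zero, deriv_deriv_rootProd_zero,
    Complex.ofReal_re]
  ring

/-- Positivity of the limit on `[0, ρ]` bounds the zeros of the approximants from below. -/
theorem eventually_mul_lt_one {F : ℂ → ℂ} (A : RootApprox F) {ρ : ℝ} (hρ : 0 ≤ ρ)
    (h : ∀ t ∈ Icc 0 ρ, 0 < (F t).re) : ∀ᶠ N in atTop, ∀ i, A.x N i * ρ < 1 := by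
  have hcont : ContinuousOn (fun t : ℝ => (F t).re) (Icc 0 ρ) :=
    (Complex.continuous_re.comp
      (A.differentiable.continuous.comp Complex.continuous_ofReal)).continuousOn
  obtain ⟨t₀, ht₀, hmin⟩ := isCompact_Icc.exists_isMinOn (nonempty_Icc.2 hρ) hcont
  have hlim := A.lim
  rw [tendstoLocallyUniformly_iff_forall_isCompact] at hlim
  have h1 := Metric.tendstoUniformlyOn_iff.1
    (hlim _ ((isCompact_Icc (a := 0) (b := ρ)).image Complex.continuous_ofReal)) _ (h t₀ ht₀)
  filter_upwards [h1] with N hN i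
  -- A factor with x ρ ≥ 1 has its root 1/x in [0, ρ], where the approximant is closer to F than the
  -- minimum of F and so cannot vanish.
  by_contra! hi
  have hx := A.pos N i
  have hmem : 1 / A.x N i ∈ Icc 0 ρ := by
    refine ⟨by positivity, ?_⟩
    rw [div_le_iff₀ hx]
    linarith
  have h2 := hN _ (mem_image_of_mem _ hmem)
  have h3 : rootProd (A.x N) ((1 / A.x N i : ℝ) : ℂ) = 0 := by
    rw [rootProd_ofReal, Complex.ofReal_eq_zero]
    refine Finset.prod_eq_zero (Finset.mem_univ i) ?_
    field_simp
    ring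
  rw [h3, dist_zero_right] at h2
  have h4 := (Complex.re_le_norm (F ((1 / A.x N i : ℝ) : ℂ))).trans_lt h2
  exact absurd (hmin hmem) (not_le.2 h4)

theorem re_le_norm {F : ℂ → ℂ} (A : RootApprox F) {r : ℝ} {w : ℂ} (hw : ‖w‖ ≤ r)
    (h : ∀ t ∈ Icc 0 r, 0 < (F t).re) : (F r).re ≤ ‖F w‖ := by
  refine le_of_tendsto_of_tendsto (A.tendsto_re r)
    (tendsto_of_tendstoLocallyUniformly A.lim w).norm ?_
  filter_upwards [A.eventually_mul_lt_one ((norm_nonneg _).trans hw) h] with N hN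
  exact prod_le_norm_rootProd (A.pos N) hw hN

theorem norm_deriv_mul_le {F : ℂ → ℂ} (A : RootApprox F) {r : ℝ} {w : ℂ} (hw : ‖w‖ ≤ r)
    (h : ∀ t ∈ Icc 0 r, 0 < (F t).re) :
    ‖deriv F w‖ * (F r).re ≤ -(deriv F r).re * ‖F w‖ := by
  refine le_of_tendsto_of_tendsto ((A.tendsto_deriv w).norm.mul (A.tendsto_re r))
    ((A.tendsto_deriv_re r).mul (tendsto_of_tendstoLocallyUniformly A.lim w).norm) ?_
  filter_upwards [A.eventually_mul_lt_one ((norm_nonneg _).trans hw) h] with N hN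
  exact norm_deriv_rootProd_mul_le (A.pos N) hw hN

/-- If no reciprocal root x of the approximants exceeds 1/ρ, then ρ x² ≤ x; sum and pass to the
limit. -/
theorem mul_zeroSqSum_le {F : ℂ → ℂ} (A : RootApprox F) {ρ : ℝ} (hρ : 0 ≤ ρ)
    (h : ∀ t ∈ Icc 0 ρ, 0 < (F t).re) : ρ * zeroSqSum F ≤ zeroSum F := by
  refine le_of_tendsto_of_tendsto (A.tendsto_zeroSqSum.const_mul ρ) A.tendsto_zeroSum ?_
  filter_upwards [A.eventually_mul_lt_one hρ h] with N hN
  rw [Finset.mul_sum]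
  refine Finset.sum_le_sum fun i _ => ?_
  nlinarith [hN i, A.pos N i]

/-- A lower bound depending only on the sum of reciprocal zeros and on the zero-free interval. It
keeps F(r) away from 0 uniformly along a family, as the continuity of the smallest zero requires. -/
theorem exp_le_re {F : ℂ → ℂ} (A : RootApprox F) {r ρ : ℝ} (hr : 0 ≤ r) (hrρ : r < ρ)
    (h : ∀ t ∈ Icc 0 ρ, 0 < (F t).re) :
    Real.exp (-(zeroSum F * (r / (1 - r / ρ)))) ≤ (F r).re := by
  have hρ : 0 < ρ := hr.trans_lt hrρ
  have hδ : 0 < 1 - r / ρ := by rw [sub_pos, div_lt_one hρ]; exact hrρ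
  refine le_of_tendsto_of_tendsto
    ((Real.continuous_exp.tendsto _).comp (A.tendsto_zeroSum.mul_const _).neg) (A.tendsto_re r) ?_
  filter_upwards [A.eventually_mul_lt_one hρ.le h] with N hN
  refine exp_le_prod _ (A.pos N) hr hδ fun i => ?_
  have : A.x N i * r ≤ r / ρ := by
    rw [le_div_iff₀ hρ]
    nlinarith [hN i]
  linarith

theorem one_le_sq_mul_zeroSqSum {F : ℂ → ℂ} (A : RootApprox F) {γ : ℝ} (hγ : F γ = 0) :
    1 ≤ γ ^ 2 * zeroSqSum F := by
  by_contra! hlt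
  have h1 := A.tendsto_zeroSqSum.const_mul (γ ^ 2)
  have h2 : 1 - γ ^ 2 * zeroSqSum F ≤ (F γ).re * (F ((-γ : ℝ) : ℂ)).re := by
    refine le_of_tendsto_of_tendsto (h1.const_sub 1) ((A.tendsto_re γ).mul (A.tendsto_re (-γ))) ?_
    filter_upwards [h1.eventually_le_const hlt] with N hN
    exact one_sub_sq_le_rootProd_mul _ hN
  rw [hγ, Complex.zero_re, zero_mul] at h2
  linarith

/-- In the extremal case of the Euler-Rayleigh upper bound all zeros coincide. -/
theorem deriv_mul_add_eq_zero {F : ℂ → ℂ} (A : RootApprox F) {γ : ℝ} (hγ : 0 < γ)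
    (h : ∀ t ∈ Ico 0 γ, 0 < (F t).re) (heq : γ * zeroSqSum F = zeroSum F) (w : ℂ) :
    deriv F w * (1 - (1 / γ : ℝ) * w) + zeroSum F * F w = 0 := by
  set R := ‖w‖
  have hR : 0 ≤ R := norm_nonneg w
  set C := R * Real.exp (zeroSum F * R)
  -- For ρ < γ both x and 1/γ are at most 1/ρ, so |1/γ - x| ≤ 2/ρ - 1/γ - x. Summed against x, this
  -- tends to S₁/γ - S₂ as ρ → γ, which is 0 by `heq`.
  have key : ∀ ρ ∈ Ioo 0 γ, ‖deriv F w * (1 - (1 / γ : ℝ) * w) + zeroSum F * F w‖ ≤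
      (2 * zeroSum F / ρ - zeroSum F / γ - zeroSqSum F) * C := by
    intro ρ hρ
    have hs := A.tendsto_zeroSum
    have hsc : Tendsto (fun N => ((∑ i, A.x N i : ℝ) : ℂ)) atTop (𝓝 (zeroSum F : ℂ)) :=
      (Complex.continuous_ofReal.tendsto _).comp hs
    refine le_of_tendsto_of_tendsto
      (((A.tendsto_deriv w).mul_const (1 - ((1 / γ : ℝ) : ℂ) * w)).add
        (hsc.mul (tendsto_of_tendstoLocallyUniformly A.lim w))).norm
      (((((hs.const_mul 2).div_const ρ).sub (hs.div_const γ)).sub A.tendsto_zeroSqSum).mul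
        (((Real.continuous_exp.tendsto _).comp (hs.mul_const R)).const_mul R)) ?_
    filter_upwards [A.eventually_mul_lt_one hρ.1.le
      fun t ht => h t ⟨ht.1, ht.2.trans_lt hρ.2⟩] with N hN
    refine (norm_deriv_rootProd_add_le (A.pos N) hR le_rfl (1 / γ)).trans ?_
    refine mul_le_mul_of_nonneg_right ?_ (by positivity)
    rw [Finset.mul_sum, Finset.sum_div, Finset.sum_div, ← Finset.sum_sub_distrib,
      ← Finset.sum_sub_distrib]
    refine Finset.sum_le_sum fun i _ => ?_
    have hx := A.pos N i
    have h1 : A.x N i ≤ 1 / ρ := by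
      rw [le_div_iff₀ hρ.1]
      exact (hN i).le
    have h2 : 1 / γ ≤ 1 / ρ := one_div_le_one_div_of_le hρ.1 hρ.2.le
    have h3 : |1 / γ - A.x N i| ≤ 2 * (1 / ρ) - 1 / γ - A.x N i := by
      rw [abs_le]
      constructor <;> linarith
    calc A.x N i * |1 / γ - A.x N i| ≤ A.x N i * (2 * (1 / ρ) - 1 / γ - A.x N i) :=
          mul_le_mul_of_nonneg_left h3 hx.le
      _ = _ := by ring
  have hlim : Tendsto (fun ρ : ℝ => (2 * zeroSum F / ρ - zeroSum F / γ - zeroSqSum F) * C)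
      (𝓝[<] γ) (𝓝 ((2 * zeroSum F / γ - zeroSum F / γ - zeroSqSum F) * C)) := by
    have : ContinuousAt
        (fun ρ : ℝ => (2 * zeroSum F / ρ - zeroSum F / γ - zeroSqSum F) * C) γ := by
      fun_prop (disch := exact hγ.ne')
    exact this.tendsto.mono_left nhdsWithin_le_nhds
  have h0 : (2 * zeroSum F / γ - zeroSum F / γ - zeroSqSum F) * C = 0 := by
    have : 2 * zeroSum F / γ - zeroSum F / γ - zeroSqSum F = 0 := by
      rw [← heq]
      field_simp
      ring
    rw [this, zero_mul]
  rw [h0] at hlim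
  have := ge_of_tendsto hlim
    (Filter.eventually_of_mem (Ioo_mem_nhdsLT hγ) key)
  exact norm_le_zero_iff.1 this

theorem mul_zeroSqSum_le_of_Ico {F : ℂ → ℂ} (A : RootApprox F) {γ : ℝ} (hγ : 0 < γ)
    (h : ∀ t ∈ Ico 0 γ, 0 < (F t).re) : γ * zeroSqSum F ≤ zeroSum F := by
  have h1 : Tendsto (fun ρ : ℝ => ρ * zeroSqSum F) (𝓝[<] γ) (𝓝 (γ * zeroSqSum F)) :=
    (by fun_prop : Continuous fun ρ : ℝ => ρ * zeroSqSum F).continuousAt.tendsto.mono_left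
      nhdsWithin_le_nhds
  refine le_of_tendsto h1 (Filter.eventually_of_mem (Ioo_mem_nhdsLT hγ) fun ρ hρ => ?_)
  exact A.mul_zeroSqSum_le hρ.1.le fun t ht => h t ⟨ht.1, ht.2.trans_lt hρ.2⟩

/-- The strict Euler-Rayleigh upper bound for the smallest zero. -/
theorem mul_zeroSqSum_lt {F : ℂ → ℂ} (A : RootApprox F) {γ : ℝ} (hγ : 0 < γ)
    (h : ∀ t ∈ Ico 0 γ, 0 < (F t).re) (hc : ∀ n, 0 < ((-1) ^ n * iteratedDeriv n F 0).re) :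
    γ * zeroSqSum F < zeroSum F := by
  refine (A.mul_zeroSqSum_le_of_Ico hγ h).lt_of_ne fun heq => ?_
  have hode := A.deriv_mul_add_eq_zero hγ h heq
  have hit : ∀ n, Differentiable ℂ (iteratedDeriv n F) := fun n =>
    (A.differentiable.contDiff (n := (n + 1 : ℕ))).differentiable_iteratedDeriv n
      (by exact_mod_cast Nat.lt_succ_self n)
  -- The n-th derivative of the differential equation, whose solution is a power of 1 - w/γ with
  -- exponent γ S₁. Its Taylor coefficients cease to alternate strictly in sign once n > γ S₁,
  -- contrary to `hc`.
  have hrec : ∀ n : ℕ, ∀ w : ℂ, iteratedDeriv (n + 1) F w * (1 - (1 / γ : ℝ) * w) =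
      (((n : ℝ) * (1 / γ) - zeroSum F : ℝ) : ℂ) * iteratedDeriv n F w := by
    intro n
    induction n with
    | zero =>
      intro w
      have := hode w
      rw [iteratedDeriv_one, iteratedDeriv_zero]
      push_cast at this ⊢
      linear_combination this
    | succ n ih =>
      intro w
      have h1 : HasDerivAt (fun w => iteratedDeriv (n + 1) F w * (1 - (1 / γ : ℝ) * w))
          (iteratedDeriv (n + 2) F w * (1 - (1 / γ : ℝ) * w)
            + iteratedDeriv (n + 1) F w * (-(1 / γ : ℝ))) w := by
        refine HasDerivAt.mul ?_ ?_
        · rw [iteratedDeriv_succ (n := n + 1)]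
          exact (hit (n + 1) w).hasDerivAt
        · simpa using ((hasDerivAt_id w).const_mul ((1 / γ : ℝ) : ℂ)).const_sub 1
      have h2 : HasDerivAt (fun w => (((n : ℝ) * (1 / γ) - zeroSum F : ℝ) : ℂ)
          * iteratedDeriv n F w)
          ((((n : ℝ) * (1 / γ) - zeroSum F : ℝ) : ℂ) * iteratedDeriv (n + 1) F w) w := by
        rw [iteratedDeriv_succ]
        exact (hit n w).hasDerivAt.const_mul _
      rw [funext ih] at h1
      have h3 := h1.unique h2
      push_cast at h3 ⊢
      linear_combination h3
  obtain ⟨n, hn⟩ := exists_nat_gt (zeroSum F * γ)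
  have h1 := hrec n 0
  rw [mul_zero, sub_zero, mul_one] at h1
  have h2 := hc (n + 1)
  have h3 : ((-1 : ℂ) ^ (n + 1) * iteratedDeriv (n + 1) F 0) =
      ((zeroSum F - (n : ℝ) * (1 / γ) : ℝ) : ℂ) * ((-1) ^ n * iteratedDeriv n F 0) := by
    rw [h1]
    push_cast
    ring
  rw [h3, Complex.re_ofReal_mul] at h2
  have h4 : zeroSum F - (n : ℝ) * (1 / γ) < 0 := by
    rw [mul_one_div, sub_neg, lt_div_iff₀ hγ]
    exact hn
  nlinarith [hc n]

end RootApprox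

/-- Without a zero on the half-line F would stay positive there, and ρ S₂ ≤ S₁ would hold for all ρ
≥ 0, which S₂ > 0 forbids. The zero set is closed, so its infimum is attained. -/
theorem RootApprox.exists_first_zero {F : ℂ → ℂ} (A : RootApprox F) (hs : 0 < zeroSqSum F) :
    ∃ γ : ℝ, 0 < γ ∧ F γ = 0 ∧ ∀ t ∈ Ico 0 γ, 0 < (F t).re := by
  have hcont : Continuous (fun t : ℝ => (F t).re) :=
    Complex.continuous_re.comp (A.differentiable.continuous.comp Complex.continuous_ofReal)
  have h0 : (F ((0 : ℝ) : ℂ)).re = 1 := by simp [A.map_zero]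
  set Z : Set ℝ := {t | 0 ≤ t ∧ (F t).re = 0} with hZ
  have hivt : ∀ t : ℝ, 0 ≤ t → (F t).re ≤ 0 → ∃ s ∈ Z, s ≤ t := by
    intro t ht hFt
    obtain ⟨s, hs, hs0⟩ := intermediate_value_Icc' ht hcont.continuousOn
      (show (0 : ℝ) ∈ Icc (F t).re (F ((0 : ℝ) : ℂ)).re from ⟨hFt, by rw [h0]; exact zero_le_one⟩)
    exact ⟨s, ⟨hs.1, hs0⟩, hs.2⟩
  have hne : Z.Nonempty := by
    by_contra hemp
    have hρ : 0 ≤ |zeroSum F| / zeroSqSum F + 1 := by positivity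
    have h1 := A.mul_zeroSqSum_le hρ fun t ht => by
      by_contra! h2
      obtain ⟨s, hs, _⟩ := hivt t ht.1 h2
      exact hemp ⟨s, hs⟩
    have h2 : (|zeroSum F| / zeroSqSum F + 1) * zeroSqSum F = |zeroSum F| + zeroSqSum F := by
      field_simp
    have := le_abs_self (zeroSum F)
    linarith
  have hbdd : BddBelow Z := ⟨0, fun t ht => ht.1⟩
  have hclosed : IsClosed Z :=
    isClosed_Ici.inter (isClosed_singleton.preimage hcont)
  have hmem := hclosed.csInf_mem hne hbdd
  refine ⟨sInf Z, lt_of_le_of_ne hmem.1 fun h => ?_, ?_, fun t ht => ?_⟩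
  · have := hmem.2
    rw [← h, h0] at this
    exact one_ne_zero this
  · rw [← A.ofReal_re, hmem.2, Complex.ofReal_zero]
  · by_contra! h2
    obtain ⟨s, hs, hst⟩ := hivt t ht.1 h2
    exact absurd (csInf_le hbdd hs) (not_le.2 (hst.trans_lt ht.2))

/-! ### Preservation of positive zeros under F ↦ F + c w F' -/

theorem exists_rootProd_of_polynomial {P : Polynomial ℂ} (h0 : P.eval 0 = 1)
    (hroot : ∀ w, P.eval w = 0 → ∃ t : ℝ, 0 < t ∧ w = t) :
    ∃ n, ∃ x : Fin n → ℝ, (∀ i, 0 < x i) ∧ ∀ w, P.eval w = rootProd x w := by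
  have hP : P ≠ 0 := by
    rintro rfl
    simp at h0
  set l := P.roots.toList with hl
  have hmem : ∀ a ∈ l, ∃ t : ℝ, 0 < t ∧ a = t := fun a ha =>
    hroot a ((Polynomial.mem_roots hP).1 (by simpa [hl] using ha))
  have heval : ∀ w, P.eval w = P.leadingCoeff * (l.map (fun a => w - a)).prod := by
    intro w
    rw [(IsAlgClosed.splits P).eval_eq_prod_roots, ← Multiset.prod_coe, ← Multiset.map_coe, hl,
      Multiset.coe_toList]
  have hfac : ∀ l' : List ℂ, (∀ a ∈ l', a ≠ 0) → ∀ w,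
      (l'.map (fun a => w - a)).prod =
        (l'.map (fun a => 0 - a)).prod * (l'.map (fun a => 1 - a⁻¹ * w)).prod := by
    intro l' h w
    induction l' with
    | nil => simp
    | cons a l' ih =>
      have ha : a ≠ 0 := h a (by simp)
      simp only [List.map_cons, List.prod_cons]
      rw [ih fun b hb => h b (by simp [hb])]
      field_simp
      ring
  refine ⟨l.length, fun i => (l[i])⁻¹.re, fun i => ?_, fun w => ?_⟩
  · obtain ⟨t, ht, hat⟩ := hmem _ (List.getElem_mem i.2)
    simp only [Fin.getElem_fin, hat, ← Complex.ofReal_inv, Complex.ofReal_re]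
    positivity
  · have h1 := heval 0
    rw [h0] at h1
    rw [heval w, hfac l (fun a ha => ?_) w, ← mul_assoc, ← h1, one_mul, rootProd,
      ← List.prod_ofFn]
    · congr 1
      refine List.ext_getElem (by simp) fun i h2 h3 => ?_
      simp only [List.getElem_map, List.getElem_ofFn, Fin.getElem_fin]
      obtain ⟨t, ht, hat⟩ := hmem (l[i]'(by simpa using h2)) (List.getElem_mem _)
      rw [hat, ← Complex.ofReal_inv, Complex.ofReal_re]
    · obtain ⟨t, ht, rfl⟩ := hmem a ha
      exact_mod_cast ht.ne'

/-- The operator `F ↦ F + c w F'`. -/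
noncomputable def eulerOp (c : ℝ) (F : ℂ → ℂ) (w : ℂ) : ℂ := F w + c * (w * deriv F w)

theorem deriv_rootProd_eq_mul_sum {n : ℕ} (x : Fin n → ℝ) {w : ℂ}
    (h : ∀ i, 1 - (x i : ℂ) * w ≠ 0) :
    deriv (rootProd x) w = -(rootProd x w * ∑ i, (x i : ℂ) / (1 - (x i : ℂ) * w)) := by
  simp only [deriv_rootProd]
  rw [Finset.mul_sum]
  congr 1
  refine Finset.sum_congr rfl fun i _ => ?_
  rw [rootProd, ← Finset.mul_prod_erase Finset.univ _ (Finset.mem_univ i)]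
  have := h i
  rw [mul_div_assoc', eq_div_iff this]
  ring

/-- Away from the zeros of P, the equation P + c w P' = 0 reads 1 = c ∑ x_i w/(1 - x_i w). Each
summand has imaginary part x_i Im w/|1 - x_i w|², all of one sign, so w is real; if w ≤ 0 the right
side is nonpositive. -/
theorem eulerOp_rootProd_root {c : ℝ} (hc : 0 < c) {n : ℕ} {x : Fin n → ℝ} (hx : ∀ i, 0 < x i)
    {w : ℂ} (hw : eulerOp c (rootProd x) w = 0) : ∃ t : ℝ, 0 < t ∧ w = t := by
  by_cases h : ∃ i, 1 - (x i : ℂ) * w = 0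
  · obtain ⟨i, hi⟩ := h
    have hxi : (x i : ℂ) ≠ 0 := by exact_mod_cast (hx i).ne'
    refine ⟨(x i)⁻¹, inv_pos.2 (hx i), ?_⟩
    rw [Complex.ofReal_inv]
    field_simp
    linear_combination -hi
  push Not at h
  have hp : rootProd x w ≠ 0 := Finset.prod_ne_zero_iff.2 fun i _ => h i
  have h1 : (1 : ℂ) - c * ∑ i, (w * (x i : ℂ) / (1 - (x i : ℂ) * w)) = 0 := by
    rw [eulerOp, deriv_rootProd_eq_mul_sum x h] at hw
    apply mul_left_cancel₀ hp
    rw [mul_zero, ← hw, show (fun i => w * (x i : ℂ) / (1 - (x i : ℂ) * w)) =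
      fun i => w * ((x i : ℂ) / (1 - (x i : ℂ) * w)) from funext fun i => mul_div_assoc _ _ _,
      ← Finset.mul_sum]
    ring
  have hN : ∀ i, 0 < Complex.normSq (1 - (x i : ℂ) * w) := fun i => Complex.normSq_pos.2 (h i)
  have hterm : ∀ i, w * (x i : ℂ) / (1 - (x i : ℂ) * w) =
      (w * x i - x i ^ 2 * Complex.normSq w) / Complex.normSq (1 - (x i : ℂ) * w) := by
    intro i
    have h2 : (Complex.normSq (1 - (x i : ℂ) * w) : ℂ) ≠ 0 := by exact_mod_cast (hN i).ne'
    rw [div_eq_div_iff (h i) h2, Complex.normSq_eq_conj_mul_self, Complex.normSq_eq_conj_mul_self]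
    simp only [map_sub, map_one, map_mul, Complex.conj_ofReal]
    ring
  simp only [hterm] at h1
  have him : w.im * ∑ i, (x i / Complex.normSq (1 - (x i : ℂ) * w)) = 0 := by
    have h2 := congrArg Complex.im h1
    rw [Complex.sub_im, Complex.one_im, Complex.im_ofReal_mul, Complex.im_sum, Complex.zero_im,
      zero_sub, neg_eq_zero, mul_eq_zero, or_iff_right hc.ne'] at h2
    rw [← h2, Finset.mul_sum]
    refine Finset.sum_congr rfl fun i _ => ?_
    rw [Complex.div_ofReal_im, Complex.sub_im, Complex.im_mul_ofReal, ← Complex.ofReal_pow,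
      ← Complex.ofReal_mul, Complex.ofReal_im, sub_zero, mul_div_assoc]
  have hre : 1 = c * ∑ i, ((w.re * x i - x i ^ 2 * Complex.normSq w) /
      Complex.normSq (1 - (x i : ℂ) * w)) := by
    have h2 := congrArg Complex.re h1
    rw [Complex.sub_re, Complex.one_re, Complex.re_ofReal_mul, Complex.re_sum, Complex.zero_re,
      sub_eq_zero] at h2
    rw [h2]
    congr 1
    refine Finset.sum_congr rfl fun i _ => ?_
    rw [Complex.div_ofReal_re, Complex.sub_re, Complex.re_mul_ofReal, ← Complex.ofReal_pow,
      ← Complex.ofReal_mul, Complex.ofReal_re]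
  have hne : (Finset.univ : Finset (Fin n)).Nonempty := by
    by_contra hemp
    rw [Finset.not_nonempty_iff_eq_empty] at hemp
    rw [hemp, Finset.sum_empty, mul_zero] at hre
    exact one_ne_zero hre
  have hwim : w.im = 0 := by
    rcases mul_eq_zero.1 him with h2 | h2
    · exact h2
    · exact absurd h2 (Finset.sum_pos (fun i _ => div_pos (hx i) (hN i)) hne).ne'
  refine ⟨w.re, ?_, Complex.ext rfl (by simpa using hwim)⟩
  by_contra! hwre
  have h2 : ∑ i, ((w.re * x i - x i ^ 2 * Complex.normSq w) /
      Complex.normSq (1 - (x i : ℂ) * w)) ≤ 0 := by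
    refine Finset.sum_nonpos fun i _ => div_nonpos_of_nonpos_of_nonneg ?_ (hN i).le
    have h3 : w.re * x i ≤ 0 := mul_nonpos_of_nonpos_of_nonneg hwre (hx i).le
    have h4 : 0 ≤ x i ^ 2 * Complex.normSq w := mul_nonneg (sq_nonneg _) (Complex.normSq_nonneg _)
    linarith
  nlinarith

theorem posRootLimit_eulerOp_rootProd {c : ℝ} (hc : 0 < c) {n : ℕ} {x : Fin n → ℝ}
    (hx : ∀ i, 0 < x i) : PosRootLimit (eulerOp c (rootProd x)) := by
  set P : Polynomial ℂ := ∏ i, (1 - Polynomial.C (x i : ℂ) * Polynomial.X) with hPdef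
  have hP : ∀ w, P.eval w = rootProd x w := fun w => by
    simp [hPdef, rootProd, Polynomial.eval_prod]
  have hd : ∀ w, P.derivative.eval w = deriv (rootProd x) w := fun w => by
    rw [← Polynomial.deriv, funext hP]
  have hQ : ∀ w, (P + Polynomial.C (c : ℂ) * (Polynomial.X * P.derivative)).eval w =
      eulerOp c (rootProd x) w := fun w => by
    simp [eulerOp, hP, hd]
  obtain ⟨m, y, hy, hyP⟩ := exists_rootProd_of_polynomial
    (P := P + Polynomial.C (c : ℂ) * (Polynomial.X * P.derivative))
    (by rw [hQ]; simp [eulerOp, rootProd_zero])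
    (fun w hw => eulerOp_rootProd_root hc hx (by rw [← hQ, hw]))
  have : eulerOp c (rootProd x) = rootProd y := funext fun w => by rw [← hQ, hyP]
  rw [this]
  exact posRootLimit_rootProd hy

theorem tendstoLocallyUniformly_eulerOp {ι : Type*} {l : Filter ι} {G : ι → ℂ → ℂ} {F : ℂ → ℂ}
    (c : ℝ) (h : TendstoLocallyUniformly G F l) (hG : ∀ i, Differentiable ℂ (G i)) :
    TendstoLocallyUniformly (fun i => eulerOp c (G i)) (eulerOp c F) l := by
  have hd := h.complex_deriv hG
  rw [tendstoLocallyUniformly_iff_forall_isCompact] at h hd ⊢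
  intro K hK
  obtain ⟨R, hR⟩ := hK.isBounded.subset_closedBall 0
  have h1 := Metric.tendstoUniformlyOn_iff.1 (h K hK)
  have h2 := Metric.tendstoUniformlyOn_iff.1 (hd K hK)
  refine Metric.tendstoUniformlyOn_iff.2 fun ε hε => ?_
  have hD : 0 < 2 * (|c| * |R| + 1) := by positivity
  filter_upwards [h1 (ε / 2) (half_pos hε), h2 (ε / (2 * (|c| * |R| + 1))) (div_pos hε hD)]
    with i hi1 hi2 w hw
  have hi1 := hi1 w hw
  have hi2 := hi2 w hw
  have hwR : ‖w‖ ≤ |R| := by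
    have := hR hw
    rw [Metric.mem_closedBall, dist_zero_right] at this
    exact this.trans (le_abs_self R)
  rw [dist_eq_norm] at hi1 hi2 ⊢
  have h3 : eulerOp c F w - eulerOp c (G i) w =
      (F w - G i w) + (c : ℂ) * (w * (deriv F w - deriv (G i) w)) := by
    rw [eulerOp, eulerOp]
    ring
  rw [h3]
  refine (norm_add_le _ _).trans_lt ?_
  rw [norm_mul, norm_mul, Complex.norm_real, Real.norm_eq_abs]
  rw [lt_div_iff₀ hD] at hi2
  have h4 : |c| * (‖w‖ * ‖deriv F w - deriv (G i) w‖) ≤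
      |c| * (|R| * ‖deriv F w - deriv (G i) w‖) := by gcongr
  have h5 := norm_nonneg (deriv F w - deriv (G i) w)
  nlinarith

theorem PosRootLimit.eulerOp {F : ℂ → ℂ} (h : PosRootLimit F) {c : ℝ} (hc : 0 < c) :
    PosRootLimit (eulerOp c F) := by
  obtain ⟨A⟩ := h.exists_approx
  exact posRootLimit_of_tendsto
    (.of_forall fun N => posRootLimit_eulerOp_rootProd hc (A.pos N))
    (tendstoLocallyUniformly_eulerOp c A.lim fun N => differentiable_rootProd _)

/-! ### Entire alternating power series -/

/-- The alternating power series with coefficients `(-1) ^ n * e n`. -/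
noncomputable def altSeries (e : ℕ → ℝ) (w : ℂ) : ℂ := ∑' n, (((-1) ^ n * e n : ℝ) : ℂ) * w ^ n

/-- Coefficients of an entire function. -/
def EntireCoeff (e : ℕ → ℝ) : Prop := ∀ R : ℝ, 0 ≤ R → Summable fun n => |e n| * R ^ n

theorem norm_altSeries_term_le (a : ℝ) {R : ℝ} (n : ℕ) {w : ℂ} (hw : ‖w‖ ≤ R) :
    ‖(((-1) ^ n * a : ℝ) : ℂ) * w ^ n‖ ≤ |a| * R ^ n := by
  rw [norm_mul, norm_pow, Complex.norm_real, Real.norm_eq_abs, abs_mul, abs_pow, abs_neg, abs_one,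
    one_pow, one_mul]
  gcongr

theorem EntireCoeff.of_le {e b : ℕ → ℝ} (hb : EntireCoeff b) (h : ∀ n, |e n| ≤ b n) :
    EntireCoeff e := fun R hR =>
  (hb R hR).of_nonneg_of_le (fun n => by positivity) fun n =>
    mul_le_mul_of_nonneg_right ((h n).trans (le_abs_self _)) (by positivity)

theorem entireCoeff_inv_factorial : EntireCoeff fun n => 1 / (n.factorial : ℝ) := fun R _ => by
  refine (Real.summable_pow_div_factorial R).congr fun n => ?_
  rw [abs_of_nonneg (by positivity)]
  ring

namespace EntireCoeff

theorem linear_mul {e : ℕ → ℝ} (he : EntireCoeff e) {c : ℝ} (hc : 0 ≤ c) :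
    EntireCoeff fun n => (1 + c * n) * e n := fun R hR => by
  refine ((he (2 * R) (by positivity)).mul_left (1 + c)).of_nonneg_of_le
    (fun n => by positivity) fun n => ?_
  have h1 : (n : ℝ) ≤ 2 ^ n := by exact_mod_cast n.lt_two_pow_self.le
  have h2 : (1 : ℝ) ≤ 2 ^ n := one_le_pow₀ one_le_two
  rw [abs_mul, abs_of_nonneg (by positivity : 0 ≤ 1 + c * n), mul_pow]
  have h3 : 1 + c * n ≤ (1 + c) * 2 ^ n := by nlinarith
  calc (1 + c * n) * |e n| * R ^ n ≤ ((1 + c) * 2 ^ n) * |e n| * R ^ n := by gcongr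
    _ = _ := by ring

theorem scale {e : ℕ → ℝ} (he : EntireCoeff e) {s : ℝ} (hs : 0 ≤ s) :
    EntireCoeff fun n => e n * s ^ n := fun R hR => by
  refine (he (s * R) (by positivity)).congr fun n => ?_
  rw [abs_mul, abs_of_nonneg (pow_nonneg hs n), mul_pow]
  ring

theorem shift {e : ℕ → ℝ} (he : EntireCoeff e) :
    EntireCoeff fun n => -((n + 1 : ℝ) * e (n + 1)) := fun R hR => by
  refine ((summable_nat_add_iff 1).2 (he.linear_mul zero_le_one (R + 1) (by linarith))).of_nonneg_of_le
    (fun n => by positivity) fun n => ?_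
  have h1 : R ^ n ≤ (R + 1) ^ (n + 1) :=
    (pow_le_pow_left₀ hR (by linarith) n).trans (pow_le_pow_right₀ (by linarith) n.le_succ)
  rw [abs_neg, abs_mul, abs_mul, abs_of_nonneg (by positivity : (0 : ℝ) ≤ n + 1),
    abs_of_nonneg (by positivity : (0 : ℝ) ≤ 1 + 1 * ((n + 1 : ℕ) : ℝ))]
  push_cast
  exact mul_le_mul (mul_le_mul_of_nonneg_right (by linarith) (abs_nonneg _)) h1 (by positivity)
    (by positivity)

theorem summable {e : ℕ → ℝ} (he : EntireCoeff e) (w : ℂ) :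
    Summable fun n => (((-1) ^ n * e n : ℝ) : ℂ) * w ^ n :=
  .of_norm_bounded (he ‖w‖ (norm_nonneg w)) fun n => norm_altSeries_term_le _ n le_rfl

theorem hasSum {e : ℕ → ℝ} (he : EntireCoeff e) (w : ℂ) :
    HasSum (fun n => (((-1) ^ n * e n : ℝ) : ℂ) * w ^ n) (altSeries e w) := (he.summable w).hasSum

theorem differentiable {e : ℕ → ℝ} (he : EntireCoeff e) : Differentiable ℂ (altSeries e) := by
  intro w
  have h : DifferentiableOn ℂ (altSeries e) (Metric.ball 0 (‖w‖ + 1)) :=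
    Complex.differentiableOn_tsum_of_summable_norm (he (‖w‖ + 1) (by positivity))
      (fun n => by fun_prop) Metric.isOpen_ball fun n z hz =>
        norm_altSeries_term_le _ n (by simpa using (mem_ball_zero_iff.1 hz).le)
  exact (h w (by simp)).differentiableAt (Metric.isOpen_ball.mem_nhds (by simp))

theorem hasSum_deriv {e : ℕ → ℝ} (he : EntireCoeff e) (w : ℂ) :
    HasSum (fun n : ℕ => (((-1) ^ n * e n : ℝ) : ℂ) * (n * w ^ (n - 1)))
      (deriv (altSeries e) w) := by
  have h := Complex.hasSum_deriv_of_summable_norm (z := w) (U := Metric.ball 0 (‖w‖ + 1))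
    (F := fun n w => (((-1) ^ n * e n : ℝ) : ℂ) * w ^ n)
    (he (‖w‖ + 1) (by positivity))
    (fun n => by fun_prop) Metric.isOpen_ball (fun n z hz =>
      norm_altSeries_term_le _ n (by simpa using (mem_ball_zero_iff.1 hz).le)) (by simp)
  refine h.congr_fun fun n => ?_
  simp

theorem deriv_eq {e : ℕ → ℝ} (he : EntireCoeff e) :
    deriv (altSeries e) = altSeries fun n => -((n + 1 : ℝ) * e (n + 1)) := by
  funext w
  have h := (hasSum_nat_add_iff' 1).2 (he.hasSum_deriv w)
  simp only [Finset.range_one, Finset.sum_singleton, Nat.cast_zero, zero_mul, mul_zero,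
    sub_zero] at h
  refine h.unique (he.shift.hasSum w |>.congr_fun fun n => ?_)
  push_cast
  ring

theorem eulerOp_eq {e : ℕ → ℝ} (he : EntireCoeff e) {c : ℝ} (hc : 0 ≤ c) :
    eulerOp c (altSeries e) = altSeries fun n => (1 + c * n) * e n := by
  funext w
  refine ((he.hasSum w).add (((he.hasSum_deriv w).mul_left w).mul_left (c : ℂ))).unique
    ((he.linear_mul hc).hasSum w |>.congr_fun fun n => ?_)
  rcases n with _ | n
  · simp
  · push_cast
    ring

theorem iteratedDeriv_zero {e : ℕ → ℝ} (he : EntireCoeff e) (n : ℕ) :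
    iteratedDeriv n (altSeries e) 0 = (((-1) ^ n * (n.factorial * e n) : ℝ) : ℂ) := by
  induction n generalizing e with
  | zero =>
    rw [_root_.iteratedDeriv_zero]
    refine (he.hasSum 0).unique ?_
    convert hasSum_single (f := fun n => (((-1) ^ n * e n : ℝ) : ℂ) * 0 ^ n) 0 ?_ using 1
    · simp
    · intro n hn
      simp [hn]
  | succ n ih =>
    rw [iteratedDeriv_succ', he.deriv_eq, ih he.shift, Nat.factorial_succ]
    push_cast
    ring

theorem zeroSum_eq {e : ℕ → ℝ} (he : EntireCoeff e) : zeroSum (altSeries e) = e 1 := by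
  rw [zeroSum, ← iteratedDeriv_one, he.iteratedDeriv_zero, Complex.ofReal_re]
  simp

theorem zeroSqSum_eq {e : ℕ → ℝ} (he : EntireCoeff e) :
    zeroSqSum (altSeries e) = e 1 ^ 2 - 2 * e 2 := by
  rw [zeroSqSum, ← iteratedDeriv_one,
    show deriv (iteratedDeriv 1 (altSeries e)) = iteratedDeriv 2 (altSeries e) from
      iteratedDeriv_succ.symm, he.iteratedDeriv_zero, he.iteratedDeriv_zero, Complex.ofReal_re,
    Complex.ofReal_re]
  simp

end EntireCoeff

theorem altSeries_mul (e : ℕ → ℝ) (s : ℝ) (w : ℂ) :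
    altSeries e (s * w) = altSeries (fun n => e n * s ^ n) w := by
  refine tsum_congr fun n => ?_
  push_cast
  ring

/-- Dominated convergence of the coefficients implies locally uniform convergence. -/
theorem tendstoLocallyUniformly_altSeries {ι : Type*} {l : Filter ι} {e : ι → ℕ → ℝ}
    {e₀ b : ℕ → ℝ} (hb : EntireCoeff b) (hle : ∀ᶠ i in l, ∀ n, |e i n| ≤ b n)
    (h₀ : ∀ n, |e₀ n| ≤ b n) (hlim : ∀ n, Tendsto (fun i => e i n) l (𝓝 (e₀ n))) :
    TendstoLocallyUniformly (fun i => altSeries (e i)) (altSeries e₀) l := by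
  rw [tendstoLocallyUniformly_iff_forall_isCompact]
  intro K hK
  obtain ⟨R, hR⟩ := hK.isBounded.subset_closedBall 0
  have hb0 : ∀ n, 0 ≤ b n := fun n => (abs_nonneg _).trans (h₀ n)
  have hsum : Summable fun n => 2 * (|b n| * |R| ^ n) := (hb |R| (abs_nonneg R)).mul_left 2
  have hbound : ∀ᶠ i in l, ∀ n, |e₀ n - e i n| * |R| ^ n ≤ 2 * (|b n| * |R| ^ n) := by
    filter_upwards [hle] with i hi n
    rw [abs_of_nonneg (hb0 n), ← mul_assoc]
    refine mul_le_mul_of_nonneg_right ?_ (by positivity)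
    exact (abs_sub _ _).trans (by linarith [hi n, h₀ n])
  -- The sum of the coefficient errors against |R|^n bounds the distance uniformly on the disk, so
  -- dominated convergence of this one numerical series suffices.
  have hdom : Tendsto (fun i => ∑' n, |e₀ n - e i n| * |R| ^ n) l (𝓝 (∑' _ : ℕ, (0 : ℝ))) := by
    refine tendsto_tsum_of_dominated_convergence hsum (fun n => ?_) ?_
    · have := (((hlim n).const_sub (e₀ n)).abs).mul_const (|R| ^ n)
      simpa using this
    · filter_upwards [hbound] with i hi n
      rw [Real.norm_of_nonneg (by positivity)]
      exact hi n
  rw [tsum_zero] at hdom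
  refine Metric.tendstoUniformlyOn_iff.2 fun ε hε => ?_
  filter_upwards [hdom.eventually_lt_const hε, hle, hbound] with i hi hle hbd w hw
  have hwR : ‖w‖ ≤ |R| := by
    have := hR hw
    rw [Metric.mem_closedBall, dist_zero_right] at this
    exact this.trans (le_abs_self R)
  have h1 := (hb.of_le h₀).hasSum w
  have h2 := (hb.of_le hle).hasSum w
  have h3 := h1.sub h2
  have h4 : ∀ n, ‖(((-1) ^ n * e₀ n : ℝ) : ℂ) * w ^ n - (((-1) ^ n * e i n : ℝ) : ℂ) * w ^ n‖ ≤
      |e₀ n - e i n| * |R| ^ n := fun n => by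
    rw [← sub_mul, ← Complex.ofReal_sub, ← mul_sub]
    exact norm_altSeries_term_le _ n hwR
  have h5 : Summable fun n => |e₀ n - e i n| * |R| ^ n :=
    hsum.of_nonneg_of_le (fun n => by positivity) hbd
  rw [dist_eq_norm, ← h3.tsum_eq]
  exact (tsum_of_norm_bounded h5.hasSum h4).trans_lt hi

/-! ### Coefficients and q-difference equation of the Hahn-Exton function -/

/-- The coefficients of the even entire function `c_ν(q) z^(-ν) J_ν^{(3)}(z; q)` in `z ^ 2`. -/
noncomputable def hahnCoeff (ν q : ℝ) (n : ℕ) : ℝ :=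
  q ^ (n * (n + 1) / 2) / (qPoch q q n * qPoch (q ^ (ν + 1)) q n)

theorem hahnCoeff_zero (ν q : ℝ) : hahnCoeff ν q 0 = 1 := by
  simp [hahnCoeff, qPoch]

section

variable {ν q : ℝ}

theorem rpow_mul_pow (hq : 0 < q) (n : ℕ) : q ^ (ν + 1) * q ^ n = q ^ (ν + n + 1) := by
  rw [← Real.rpow_natCast, ← Real.rpow_add hq]
  congr 1
  ring

theorem one_sub_pow_succ_pos (hq : 0 < q) (hq1 : q < 1) (n : ℕ) : 0 < 1 - q ^ (n + 1) :=
  sub_pos.2 (pow_lt_one₀ hq.le hq1 n.succ_ne_zero)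

theorem one_sub_rpow_pos (hq : 0 < q) (hq1 : q < 1) {s : ℝ} (hs : 0 < s) : 0 < 1 - q ^ s :=
  sub_pos.2 (Real.rpow_lt_one hq.le hq1 hs)

theorem hahnCoeff_succ (hq : 0 < q) (n : ℕ) : hahnCoeff ν q (n + 1) =
    hahnCoeff ν q n * (q ^ (n + 1) / ((1 - q ^ (n + 1)) * (1 - q ^ (ν + n + 1)))) := by
  have h1 : (n + 1) * (n + 1 + 1) / 2 = n * (n + 1) / 2 + (n + 1) := by
    rw [show (n + 1) * (n + 1 + 1) = n * (n + 1) + (n + 1) * 2 by ring,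
      Nat.add_mul_div_right _ _ two_pos]
  rw [hahnCoeff, hahnCoeff, qPoch, qPoch, Finset.prod_range_succ, Finset.prod_range_succ,
    ← qPoch, ← qPoch, h1, pow_add, rpow_mul_pow hq, ← pow_succ', div_mul_div_comm]
  congr 1
  ring

theorem hahnCoeff_pos (hν : 0 < ν) (hq : 0 < q) (hq1 : q < 1) (n : ℕ) : 0 < hahnCoeff ν q n := by
  induction n with
  | zero => rw [hahnCoeff_zero]; exact one_pos
  | succ n ih =>
    rw [hahnCoeff_succ hq]
    have h1 := one_sub_pow_succ_pos hq hq1 n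
    have h2 := one_sub_rpow_pos hq hq1 (s := ν + n + 1) (by positivity)
    positivity

/-- The geometric sum (1 - q^(n+1))/(1 - q) has n + 1 terms, each at least q^(n+1). -/
theorem mul_pow_mul_one_sub_le (hq : 0 < q) (hq1 : q < 1) (n : ℕ) :
    q ^ (n + 1) * (1 - q) / (1 - q ^ (n + 1)) ≤ 1 / (n + 1) := by
  have h1 := one_sub_pow_succ_pos hq hq1 n
  rw [div_le_div_iff₀ h1 (by positivity), one_mul, ← mul_neg_geom_sum q (n + 1),
    mul_comm (1 - q), mul_right_comm]
  refine mul_le_mul_of_nonneg_right ?_ (by linarith)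
  have h2 := Finset.card_nsmul_le_sum (Finset.range (n + 1)) (fun i => q ^ i) (q ^ (n + 1))
    fun i hi => pow_le_pow_of_le_one hq.le hq1.le (Finset.mem_range.1 hi).le
  rw [Finset.card_range, nsmul_eq_mul] at h2
  push_cast at h2
  linarith

/-- The bound does not depend on q. It serves twice: for fixed q it makes the series entire, and for
q → 1 it is the dominating sequence. -/
theorem hahnCoeff_mul_le (hν : 0 < ν) (hq : 0 < q) (hq1 : q < 1) (n : ℕ) :
    hahnCoeff ν q n * ((1 - q) ^ 2) ^ n ≤ 1 / n.factorial := by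
  induction n with
  | zero => simp [hahnCoeff_zero]
  | succ n ih =>
    have h1 := one_sub_pow_succ_pos hq hq1 n
    have h2 := one_sub_rpow_pos hq hq1 (s := ν + n + 1) (by positivity)
    have h3 : 0 < 1 - q := sub_pos.2 hq1
    have h4 : (1 - q) / (1 - q ^ (ν + n + 1)) ≤ 1 := by
      rw [div_le_one h2]
      have h5 : q ^ (ν + n + 1) ≤ q ^ (1 : ℝ) :=
        Real.rpow_le_rpow_of_exponent_ge hq hq1.le (by linarith [n.cast_nonneg (α := ℝ)])
      rw [Real.rpow_one] at h5
      linarith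
    have h6 := mul_pow_mul_one_sub_le hq hq1 n
    calc hahnCoeff ν q (n + 1) * ((1 - q) ^ 2) ^ (n + 1)
        = (hahnCoeff ν q n * ((1 - q) ^ 2) ^ n) * ((q ^ (n + 1) * (1 - q) / (1 - q ^ (n + 1))) *
            ((1 - q) / (1 - q ^ (ν + n + 1)))) := by
          rw [hahnCoeff_succ hq, pow_succ ((1 - q) ^ 2)]
          generalize ((1 - q) ^ 2) ^ n = P
          field_simp
      _ ≤ (1 / (n.factorial : ℝ)) * ((1 / ((n : ℝ) + 1)) * 1) := by
          gcongr
      _ = _ := by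
          rw [Nat.factorial_succ]
          push_cast
          field_simp

theorem entireCoeff_hahnCoeff (hν : 0 < ν) (hq : 0 < q) (hq1 : q < 1) :
    EntireCoeff (hahnCoeff ν q) := by
  have h3 : 0 < 1 - q := sub_pos.2 hq1
  refine (entireCoeff_inv_factorial.scale (s := ((1 - q) ^ 2)⁻¹) (by positivity)).of_le fun n => ?_
  rw [abs_of_pos (hahnCoeff_pos hν hq hq1 n), inv_pow, ← div_eq_mul_inv,
    le_div_iff₀ (by positivity)]
  exact hahnCoeff_mul_le hν hq hq1 n

/-- The second order `q`-difference equation of the Hahn-Exton function. -/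
theorem altSeries_hahnCoeff_eq (hν : 0 < ν) (hq : 0 < q) (hq1 : q < 1) (v : ℂ) :
    altSeries (hahnCoeff ν q) v =
      (1 + (q ^ ν : ℝ) - q * v) * altSeries (hahnCoeff ν q) (q * v)
        - (q ^ ν : ℝ) * altSeries (hahnCoeff ν q) (q * (q * v)) := by
  have he := entireCoeff_hahnCoeff hν hq hq1
  have h1 := ((he.hasSum v).sub ((he.hasSum (q * v)).mul_left (1 + ((q ^ ν : ℝ) : ℂ)))).add
    ((he.hasSum (q * (q * v))).mul_left ((q ^ ν : ℝ) : ℂ))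
  have h2 := (he.hasSum (q * v)).mul_left (-(q * v))
  -- With a = q^ν, the coefficient of index n on this side carries the factor 1 - (1 + a) q^n + a
  -- q^(2n) = (1 - q^n)(1 - a q^n). It vanishes at n = 0, and for n + 1 it is the denominator in the
  -- coefficient recursion.
  have h3 := (hasSum_nat_add_iff' 1).2 h1
  have h4 := h3.unique (h2.congr_fun fun n => ?_)
  · simp only [Finset.range_one, Finset.sum_singleton, pow_zero, mul_one, hahnCoeff_zero,
      Complex.ofReal_one] at h4
    linear_combination h4
  · have h5 : 1 - q ^ (n + 1) ≠ 0 := (one_sub_pow_succ_pos hq hq1 n).ne'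
    have h6 : 1 - q ^ (ν + n + 1) ≠ 0 :=
      (one_sub_rpow_pos hq hq1 (s := ν + n + 1) (by positivity)).ne'
    have h7 : hahnCoeff ν q (n + 1) * ((1 - q ^ (n + 1)) * (1 - q ^ ν * q ^ (n + 1))) =
        hahnCoeff ν q n * q ^ (n + 1) := by
      have h8 : q ^ ν * q ^ (n + 1) = q ^ (ν + n + 1) := by
        rw [← rpow_mul_pow hq, Real.rpow_add_one hq.ne']
        ring
      rw [hahnCoeff_succ hq, h8]
      field_simp
    have h9 : (hahnCoeff ν q (n + 1) : ℂ) *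
        ((1 - (q : ℂ) ^ (n + 1)) * (1 - ((q ^ ν : ℝ) : ℂ) * (q : ℂ) ^ (n + 1))) =
        hahnCoeff ν q n * (q : ℂ) ^ (n + 1) := by exact_mod_cast h7
    push_cast
    linear_combination ((-1) ^ (n + 1) * v ^ (n + 1)) * h9

end

/-! ### Positivity of the zeros of the Hahn-Exton series by backward recurrence -/

/-- The backward solution of the `q`-difference equation with constant initial values. -/
noncomputable def backPoly (a q : ℝ) : ℕ → Polynomial ℂ
  | 0 => 1
  | 1 => 1 - Polynomial.X
  | n + 2 => (1 + Polynomial.C (a : ℂ) - Polynomial.C (((q⁻¹) ^ (n + 1) : ℝ) : ℂ) * Polynomial.X) *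
      backPoly a q (n + 1) - Polynomial.C (a : ℂ) * backPoly a q n

theorem eval_backPoly_add_two (a q : ℝ) (n : ℕ) (w : ℂ) :
    (backPoly a q (n + 2)).eval w = (1 + a - ((q⁻¹) ^ (n + 1) : ℝ) * w) *
      (backPoly a q (n + 1)).eval w - a * (backPoly a q n).eval w := by
  rw [backPoly]
  simp only [Polynomial.eval_sub, Polynomial.eval_mul, Polynomial.eval_add, Polynomial.eval_one,
    Polynomial.eval_C, Polynomial.eval_X]

section

variable {a q : ℝ}

theorem eval_backPoly_zero (n : ℕ) :
    (backPoly a q n).eval 0 = 1 ∧ (backPoly a q (n + 1)).eval 0 = 1 := by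
  induction n with
  | zero => simp [backPoly]
  | succ n ih =>
    refine ⟨ih.2, ?_⟩
    rw [eval_backPoly_add_two, ih.1, ih.2]
    ring

/-- A Christoffel-Darboux type sign argument: one step of the recurrence multiplies Im (P_{n+1} conj
P_n) by a > 0 and adds a term whose sign is opposite to that of Im w. Hence no P_n vanishes off the
real axis. -/
theorem eval_backPoly_im (ha : 0 < a) (hq : 0 < q) {w : ℂ} (hw : w.im ≠ 0) (n : ℕ) :
    w.im * ((backPoly a q (n + 1)).eval w * (starRingEnd ℂ) ((backPoly a q n).eval w)).im < 0 := by
  induction n with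
  | zero =>
    simp only [backPoly, Polynomial.eval_sub, Polynomial.eval_one, Polynomial.eval_X, map_one,
      mul_one, Complex.sub_im, Complex.one_im, zero_sub]
    have := mul_self_pos.2 hw
    linarith
  | succ n ih =>
    rw [eval_backPoly_add_two]
    set Y := (backPoly a q (n + 1)).eval w
    set X := (backPoly a q n).eval w
    have h1 : (((1 + a - ((q⁻¹) ^ (n + 1) : ℝ) * w) * Y - a * X) * (starRingEnd ℂ) Y).im =
        -((q⁻¹) ^ (n + 1) * w.im * Complex.normSq Y) + a * (Y * (starRingEnd ℂ) X).im := by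
      simp only [Complex.mul_im, Complex.sub_im, Complex.sub_re, Complex.mul_re, Complex.add_re,
        Complex.add_im, Complex.one_re, Complex.one_im, Complex.ofReal_re, Complex.ofReal_im,
        Complex.conj_re, Complex.conj_im, Complex.normSq_apply]
      ring
    rw [h1]
    have h2 : 0 ≤ (q⁻¹) ^ (n + 1) * (w.im * w.im) * Complex.normSq Y :=
      mul_nonneg (mul_nonneg (by positivity) (mul_self_nonneg _)) (Complex.normSq_nonneg _)
    nlinarith

/-- For t ≤ 0 the increments satisfy y'' - y' = a (y' - y) - q^(-(n+1)) t y', so the values increase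
from 1 and never vanish. -/
theorem eval_backPoly_of_nonpos (ha : 0 < a) (hq : 0 < q) {t : ℝ} (ht : t ≤ 0) (n : ℕ) :
    ∃ y y' : ℝ, (backPoly a q n).eval (t : ℂ) = y ∧ (backPoly a q (n + 1)).eval (t : ℂ) = y' ∧
      1 ≤ y ∧ y ≤ y' := by
  induction n with
  | zero => exact ⟨1, 1 - t, by simp [backPoly], by simp [backPoly], le_rfl, by linarith⟩
  | succ n ih =>
    obtain ⟨y, y', h1, h2, h3, h4⟩ := ih
    refine ⟨y', (1 + a - (q⁻¹) ^ (n + 1) * t) * y' - a * y, h2, ?_, h3.trans h4, ?_⟩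
    · rw [eval_backPoly_add_two, h1, h2]
      push_cast
      ring
    · have h5 : 0 ≤ (q⁻¹) ^ (n + 1) * (-t) * y' :=
        mul_nonneg (mul_nonneg (by positivity) (by linarith)) (by linarith)
      nlinarith

theorem backPoly_root (ha : 0 < a) (hq : 0 < q) (n : ℕ) {w : ℂ}
    (hw : (backPoly a q n).eval w = 0) : ∃ t : ℝ, 0 < t ∧ w = t := by
  have him : w.im = 0 := by
    by_contra h
    have := eval_backPoly_im ha hq h n
    rw [hw] at this
    simp at this
  have hwr : w = (w.re : ℂ) := Complex.ext rfl (by simpa using him)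
  refine ⟨w.re, ?_, hwr⟩
  by_contra! hre
  obtain ⟨y, -, h1, -, h2, -⟩ := eval_backPoly_of_nonpos ha hq hre n
  rw [← hwr, hw] at h1
  have : y = 0 := by exact_mod_cast h1.symm
  linarith

theorem exists_rootProd_backPoly (ha : 0 < a) (hq : 0 < q) (n : ℕ) {s : ℝ} (hs : 0 < s) :
    ∃ m, ∃ x : Fin m → ℝ, (∀ i, 0 < x i) ∧
      ∀ w, (backPoly a q n).eval ((s : ℂ) * w) = rootProd x w := by
  obtain ⟨m, x, hx, h⟩ := exists_rootProd_of_polynomial (eval_backPoly_zero (a := a) (q := q) n).1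
    (fun w hw => backPoly_root ha hq n hw)
  refine ⟨m, fun i => x i * s, fun i => mul_pos (hx i) hs, fun w => ?_⟩
  rw [h, rootProd, rootProd]
  refine Finset.prod_congr rfl fun i _ => ?_
  push_cast
  ring

/-- Stability of the backward recurrence. -/
theorem norm_backward_le (ha : 0 < a) (ha1 : a < 1) (hq : 0 < q) (hq1 : q < 1) {D : ℕ → ℂ}
    {u : ℂ} (hD : ∀ n, D (n + 2) = (1 + a - ((q⁻¹) ^ (n + 1) : ℝ) * u) * D (n + 1) - a * D n)
    (n : ℕ) :
    ‖D (n + 1)‖ + a / (1 - a) * ‖D (n + 1) - D n‖ ≤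
      (‖D 1‖ + a / (1 - a) * ‖D 1 - D 0‖) *
        Real.exp (1 / (1 - a) * ‖u‖ / (1 - q) * (q⁻¹) ^ n) := by
  have ha' : 0 < 1 - a := sub_pos.2 ha1
  have hq' : 0 < 1 - q := sub_pos.2 hq1
  induction n with
  | zero =>
    refine le_mul_of_one_le_right (by positivity) (Real.one_le_exp (by positivity))
  | succ n ih =>
    set E := D (n + 2) - D (n + 1) with hE
    have h1 : E = a * (D (n + 1) - D n) - ((q⁻¹) ^ (n + 1) : ℝ) * (u * D (n + 1)) := by
      rw [hE, hD]
      ring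
    have h2 : ‖E‖ ≤ a * ‖D (n + 1) - D n‖ + (q⁻¹) ^ (n + 1) * (‖u‖ * ‖D (n + 1)‖) := by
      rw [h1]
      refine (norm_sub_le _ _).trans (le_of_eq ?_)
      rw [norm_mul, norm_mul, norm_mul, Complex.norm_real, Complex.norm_real,
        Real.norm_of_nonneg ha.le, Real.norm_of_nonneg (by positivity)]
    have h3 : ‖D (n + 2)‖ ≤ ‖D (n + 1)‖ + ‖E‖ := by
      have : D (n + 2) = D (n + 1) + E := by rw [hE]; ring
      rw [this]
      exact norm_add_le _ _
    set T := 1 / (1 - a) * ‖u‖ * (q⁻¹) ^ (n + 1) with hT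
    have hT0 : 0 ≤ T := by positivity
    -- The weight k = a/(1 - a) solves (1 + k) a = k, so the recurrence with u = 0 does not increase
    -- the weighted norm; the term in u costs the factor 1 + T.
    have h4 : ‖D (n + 2)‖ + a / (1 - a) * ‖E‖ ≤
        (‖D (n + 1)‖ + a / (1 - a) * ‖D (n + 1) - D n‖) * (1 + T) := by
      have h5 : ‖D (n + 2)‖ + a / (1 - a) * ‖E‖ ≤ ‖D (n + 1)‖ + 1 / (1 - a) * ‖E‖ := by
        have : 1 / (1 - a) * ‖E‖ = ‖E‖ + a / (1 - a) * ‖E‖ := by field_simp; ring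
        linarith
      have h6 : 1 / (1 - a) * ‖E‖ ≤
          a / (1 - a) * ‖D (n + 1) - D n‖ + T * ‖D (n + 1)‖ := by
        refine (mul_le_mul_of_nonneg_left h2 (by positivity)).trans (le_of_eq ?_)
        rw [hT]
        ring
      have h7 : 0 ≤ a / (1 - a) * ‖D (n + 1) - D n‖ * T := by positivity
      nlinarith
    refine h4.trans ?_
    refine (mul_le_mul_of_nonneg_right ih (by positivity)).trans ?_
    rw [mul_assoc]
    refine mul_le_mul_of_nonneg_left ?_ (by positivity)
    have h8 : 1 + T ≤ Real.exp T := by linarith [Real.add_one_le_exp T]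
    -- The exponents add up geometrically: q^(-n)/(1 - q) + q^(-(n+1)) = q^(-(n+1))/(1 - q).
    refine (mul_le_mul_of_nonneg_left h8 (Real.exp_pos _).le).trans (le_of_eq ?_)
    rw [← Real.exp_add, hT]
    congr 1
    rw [pow_succ]
    field_simp
    ring

end

/-- The values Φ(q^(-n) u) obey the recurrence of `backPoly`, and for small u both sequences start
near 1. With u = q^(N+1) w the polynomial of index N + 1 is thus compared with Φ(w) itself. -/
theorem posRootLimit_hahnCoeff {ν q : ℝ} (hν : 0 < ν) (hq : 0 < q) (hq1 : q < 1) :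
    PosRootLimit (altSeries (hahnCoeff ν q)) := by
  intro R ε hε
  set a := q ^ ν with ha_def
  have ha : 0 < a := Real.rpow_pos_of_pos hq ν
  have ha1 : a < 1 := Real.rpow_lt_one hq.le hq1 hν
  have ha' : 0 < 1 - a := sub_pos.2 ha1
  have hq' : 0 < 1 - q := sub_pos.2 hq1
  set Φ := altSeries (hahnCoeff ν q) with hΦ
  have he := entireCoeff_hahnCoeff hν hq hq1
  have hcont : Continuous Φ := he.differentiable.continuous
  have hΦ0 : Φ 0 = 1 := by
    have := he.iteratedDeriv_zero 0
    simpa [hahnCoeff_zero] using this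
  have hqc : (q : ℂ) ≠ 0 := by exact_mod_cast hq.ne'
  set D : ℂ → ℕ → ℂ := fun u n => (backPoly a q n).eval u - Φ (((q⁻¹ ^ n : ℝ) : ℂ) * u) with hD_def
  have hD : ∀ u n, D u (n + 2) =
      (1 + a - ((q⁻¹) ^ (n + 1) : ℝ) * u) * D u (n + 1) - a * D u n := by
    intro u n
    have h1 := altSeries_hahnCoeff_eq hν hq hq1 (((q⁻¹ ^ (n + 2) : ℝ) : ℂ) * u)
    have h2 : (q : ℂ) * (((q⁻¹ ^ (n + 2) : ℝ) : ℂ) * u) = ((q⁻¹ ^ (n + 1) : ℝ) : ℂ) * u := by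
      push_cast
      rw [pow_succ _ (n + 1)]
      field_simp
    have h3 : (q : ℂ) * (((q⁻¹ ^ (n + 1) : ℝ) : ℂ) * u) = ((q⁻¹ ^ n : ℝ) : ℂ) * u := by
      push_cast
      rw [pow_succ _ n]
      field_simp
    rw [h2, h3, ← ha_def, ← hΦ] at h1
    simp only [hD_def]
    rw [eval_backPoly_add_two, h1]
    ring
  set m : ℂ → ℝ := fun u => ‖D u 1‖ + a / (1 - a) * ‖D u 1 - D u 0‖ with hm
  have hDc : ∀ n, Continuous fun u => D u n := fun n => by
    simp only [hD_def]
    exact (Polynomial.continuous _).sub (hcont.comp (by fun_prop))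
  have hmc : Continuous m := by
    have := hDc 0
    have := hDc 1
    fun_prop
  have hm0 : m 0 = 0 := by
    simp [hm, hD_def, hΦ0, (eval_backPoly_zero 0).1, (eval_backPoly_zero 0).2]
  -- Bounds the error amplification for every N, because ‖u‖ q^(-N) = q ‖w‖ ≤ |R|. Only the initial
  -- error `m u` has to be made small.
  set K := Real.exp (1 / (1 - a) * |R| / (1 - q)) with hK
  obtain ⟨δ, hδ, hmδ⟩ := Metric.continuousAt_iff.1 (hmc.continuousAt (x := (0 : ℂ))) (ε / K)
    (div_pos hε (Real.exp_pos _))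
  obtain ⟨N, hN⟩ : ∃ N : ℕ, |R| * q ^ (N + 1) < δ := by
    have h1 : Tendsto (fun N : ℕ => |R| * q ^ (N + 1)) atTop (𝓝 (|R| * 0)) :=
      ((tendsto_pow_atTop_nhds_zero_of_lt_one hq.le hq1).comp (tendsto_add_atTop_nat 1)).const_mul _
    rw [mul_zero] at h1
    exact (h1.eventually_lt_const hδ).exists
  obtain ⟨n, x, hx, hxZ⟩ := exists_rootProd_backPoly ha hq (N + 1) (s := q ^ (N + 1))
    (by positivity)
  refine ⟨n, x, hx, fun w hw => ?_⟩
  have hw' : ‖w‖ ≤ |R| := hw.trans (le_abs_self R)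
  set u : ℂ := ((q ^ (N + 1) : ℝ) : ℂ) * w with hu
  have hun : ‖u‖ = q ^ (N + 1) * ‖w‖ := by
    rw [hu, norm_mul, Complex.norm_real, Real.norm_of_nonneg (by positivity)]
  have h1 := norm_backward_le ha ha1 hq hq1 (hD u) N
  have h2 : D u (N + 1) = rootProd x w - Φ w := by
    simp only [hD_def]
    rw [hxZ]
    congr 2
    rw [hu, ← mul_assoc, ← Complex.ofReal_mul, ← mul_pow, inv_mul_cancel₀ hq.ne', one_pow,
      Complex.ofReal_one, one_mul]
  have h3 : m u < ε / K := by
    have := hmδ (x := u) (by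
      rw [dist_zero_right, hun, mul_comm]
      exact (mul_le_mul_of_nonneg_right hw' (by positivity)).trans_lt hN)
    rw [hm0, dist_zero_right] at this
    exact (le_abs_self _).trans_lt this
  have h4 : Real.exp (1 / (1 - a) * ‖u‖ / (1 - q) * (q⁻¹) ^ N) ≤ K := by
    rw [hK, Real.exp_le_exp, hun]
    have h5 : 1 / (1 - a) * (q ^ (N + 1) * ‖w‖) / (1 - q) * (q⁻¹) ^ N =
        1 / (1 - a) * (q * ‖w‖) / (1 - q) := by
      rw [pow_succ, inv_pow]
      field_simp
    rw [h5]
    have h6 : q * ‖w‖ ≤ |R| := by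
      have := norm_nonneg w
      nlinarith
    gcongr
  rw [norm_sub_rev, ← h2]
  have h5 : 0 ≤ a / (1 - a) * ‖D u (N + 1) - D u N‖ := by positivity
  have h6 : 0 ≤ m u := by positivity
  calc ‖D u (N + 1)‖ ≤ m u * K := by
        refine le_trans ?_ (mul_le_mul_of_nonneg_left h4 h6)
        linarith
    _ ≤ ε / K * K := mul_le_mul_of_nonneg_right h3.le (Real.exp_pos _).le
    _ = ε := div_mul_cancel₀ _ (Real.exp_pos _).ne'

/-! ### Bounds, continuity and critical points for the smallest positive zero -/

/-- `γ` is the smallest positive zero of `F`, and `F` is positive on `[0, γ)`. -/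
structure IsFirstZero (F : ℂ → ℂ) (γ : ℝ) : Prop where
  pos : 0 < γ
  zero : F γ = 0
  re_pos : ∀ t ∈ Ico 0 γ, 0 < (F t).re

theorem IsFirstZero.le {F : ℂ → ℂ} {γ t : ℝ} (h : IsFirstZero F γ) (ht : 0 ≤ t) (hF : F t = 0) :
    γ ≤ t := by
  by_contra! hlt
  have := h.re_pos t ⟨ht, hlt⟩
  rw [hF] at this
  exact lt_irrefl _ this

theorem IsFirstZero.scale {F : ℂ → ℂ} {γ s : ℝ} (h : IsFirstZero F γ) (hs : 0 < s) :
    IsFirstZero (fun w => F (s * w)) (γ / s) := by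
  have hsc : (s : ℂ) ≠ 0 := by exact_mod_cast hs.ne'
  refine ⟨div_pos h.pos hs, ?_, fun t ht => ?_⟩
  · rw [Complex.ofReal_div, mul_div_cancel₀ _ hsc]
    exact h.zero
  · have := h.re_pos (s * t) ⟨mul_nonneg hs.le ht.1, by
      rw [mul_comm]; exact (lt_div_iff₀ hs).1 ht.2⟩
    simpa using this

theorem PosRootLimit.scale {F : ℂ → ℂ} (h : PosRootLimit F) {s : ℝ} (hs : 0 < s) :
    PosRootLimit (fun w => F (s * w)) := by
  intro R ε hε
  obtain ⟨n, x, hx, hF⟩ := h (s * R) ε hε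
  refine ⟨n, fun i => x i * s, fun i => mul_pos (hx i) hs, fun w hw => ?_⟩
  have h1 : rootProd (fun i => x i * s) w = rootProd x (s * w) := by
    refine Finset.prod_congr rfl fun i _ => ?_
    push_cast
    ring
  rw [h1]
  refine hF _ ?_
  rw [norm_mul, Complex.norm_real, Real.norm_of_nonneg hs.le]
  gcongr

/-- The first Euler-Rayleigh bounds for the smallest zero, in terms of the coefficients. -/
theorem exists_isFirstZero {e : ℕ → ℝ} (he : EntireCoeff e) (hpos : ∀ n, 0 < e n)
    (hL : PosRootLimit (altSeries e)) (hs : 0 < e 1 ^ 2 - 2 * e 2) :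
    ∃ γ, IsFirstZero (altSeries e) γ ∧ 1 / e 1 < γ ∧ γ < e 1 / (e 1 ^ 2 - 2 * e 2) := by
  obtain ⟨A⟩ := hL.exists_approx
  have hS1 := he.zeroSum_eq
  have hS2 := he.zeroSqSum_eq
  obtain ⟨γ, hγ, h0, hp⟩ := A.exists_first_zero (by rw [hS2]; exact hs)
  refine ⟨γ, ⟨hγ, h0, hp⟩, ?_, ?_⟩
  · have h1 := A.one_le_sq_mul_zeroSqSum h0
    rw [hS2] at h1
    -- Strictness comes from e₂ > 0: 1 ≤ γ² (e₁² - 2 e₂) < (γ e₁)².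
    have h2 : 1 < (γ * e 1) ^ 2 := by
      have := mul_pos (pow_pos hγ 2) (hpos 2)
      nlinarith
    rw [div_lt_iff₀ (hpos 1)]
    have h3 := mul_pos hγ (hpos 1)
    nlinarith
  · have h1 := A.mul_zeroSqSum_lt hγ hp fun n => by
      rw [he.iteratedDeriv_zero]
      have h2 : ((-1 : ℂ) ^ n * (((-1) ^ n * (n.factorial * e n) : ℝ) : ℂ)) =
          ((n.factorial * e n : ℝ) : ℂ) := by
        push_cast
        rw [← mul_assoc, ← mul_pow]
        norm_num
      rw [h2, Complex.ofReal_re]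
      exact mul_pos (by exact_mod_cast n.factorial_pos) (hpos n)
    rw [hS1, hS2] at h1
    rwa [lt_div_iff₀ hs]

/-- The smallest zero depends continuously on the function. -/
theorem tendsto_isFirstZero {ι : Type*} {l : Filter ι} {G : ι → ℂ → ℂ} {F : ℂ → ℂ}
    (hlim : TendstoLocallyUniformly G F l) (hd : ∀ i, Differentiable ℂ (G i))
    (hG : ∀ᶠ i in l, PosRootLimit (G i)) {g : ι → ℝ} {γ : ℝ}
    (hg : ∀ᶠ i in l, IsFirstZero (G i) (g i)) (hγ : IsFirstZero F γ) :
    Tendsto g l (𝓝 γ) := by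
  rw [tendsto_order]
  refine ⟨fun a ha => ?_, fun b hb => ?_⟩
  · rcases lt_or_ge a 0 with h | h
    · filter_upwards [hg] with i hi
      exact h.trans hi.pos
    have hF : Differentiable ℂ F ∨ l = ⊥ := by
      rcases eq_or_neBot l with hl | hl
      · exact .inr hl
      · rw [← tendstoLocallyUniformlyOn_univ] at hlim
        exact .inl (differentiableOn_univ.1 (hlim.differentiableOn
          (.of_forall fun i => (hd i).differentiableOn) isOpen_univ))
    rcases hF with hF | rfl
    swap
    · exact eventually_bot
    have hcont : ContinuousOn (fun t : ℝ => (F t).re) (Icc 0 a) :=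
      (Complex.continuous_re.comp (hF.continuous.comp Complex.continuous_ofReal)).continuousOn
    -- F has a positive minimum on [0, a], so a function uniformly closer to F than this minimum has
    -- no zero there.
    obtain ⟨t₀, ht₀, hmin⟩ := isCompact_Icc.exists_isMinOn (nonempty_Icc.2 h) hcont
    rw [tendstoLocallyUniformly_iff_forall_isCompact] at hlim
    have h1 := Metric.tendstoUniformlyOn_iff.1
      (hlim _ ((isCompact_Icc (a := 0) (b := a)).image Complex.continuous_ofReal)) _
      (hγ.re_pos t₀ ⟨ht₀.1, ht₀.2.trans_lt ha⟩)
    filter_upwards [h1, hg] with i hi hgi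
    by_contra! hle
    have hmem : g i ∈ Icc 0 a := ⟨hgi.pos.le, hle⟩
    have h2 := hi _ (mem_image_of_mem _ hmem)
    rw [hgi.zero, dist_zero_right] at h2
    exact absurd (hmin hmem) (not_le.2 ((Complex.re_le_norm _).trans_lt h2))
  -- If G_i had no zero before b, it would be positive on [0, ρ], and `RootApprox.exp_le_re` would
  -- bound G_i(γ) below uniformly in i, although G_i(γ) → F(γ) = 0.
  · set ρ := (γ + b) / 2 with hρ
    have hγρ : γ < ρ := by rw [hρ]; linarith
    have hρb : ρ < b := by rw [hρ]; linarith
    have hval : Tendsto (fun i => (G i γ).re) l (𝓝 0) := by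
      have := (Complex.continuous_re.tendsto _).comp
        (tendsto_of_tendstoLocallyUniformly hlim (γ : ℂ))
      rw [hγ.zero] at this
      exact this
    have hsum : Tendsto (fun i => zeroSum (G i)) l (𝓝 (zeroSum F)) :=
      ((Complex.continuous_re.tendsto _).comp
        (tendsto_of_tendstoLocallyUniformly (hlim.complex_deriv hd) 0)).neg
    have hexp : Tendsto (fun i => Real.exp (-(zeroSum (G i) * (γ / (1 - γ / ρ))))) l
        (𝓝 (Real.exp (-(zeroSum F * (γ / (1 - γ / ρ)))))) :=
      (Real.continuous_exp.tendsto _).comp (hsum.mul_const _).neg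
    filter_upwards [hval.eventually_lt hexp (Real.exp_pos _), hg, hG] with i hi hgi hGi
    by_contra! hle
    obtain ⟨A⟩ := hGi.exists_approx
    have := A.exp_le_re hγ.pos.le hγρ fun t ht =>
      hgi.re_pos t ⟨ht.1, ht.2.trans_lt (hρb.trans_le hle)⟩
    linarith

theorem eulerOp_re {F : ℂ → ℂ} (c t : ℝ) :
    (eulerOp c F t).re = (F t).re + c * (t * (deriv F t).re) := by
  simp [eulerOp]

/-- `F` has no zero up to the smallest zero of `F + c w F'`. -/
theorem IsFirstZero.re_pos_of_eulerOp {F : ℂ → ℂ} (hF : Differentiable ℂ F) {c γ : ℝ} (hc : 0 < c)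
    (h : IsFirstZero (eulerOp c F) γ) {t : ℝ} (ht : t ∈ Ioc 0 γ) : 0 < (F t).re := by
  set k := 1 / c with hk
  have hk0 : 0 < k := by positivity
  have hcont : Continuous fun t : ℝ => t ^ k * (F t).re :=
    (Real.continuous_rpow_const hk0.le).mul
      (Complex.continuous_re.comp (hF.continuous.comp Complex.continuous_ofReal))
  -- With k = 1/c, the derivative of t^k F(t) is k t^(k-1) (F + c t F'), positive on (0, γ); and t^k
  -- F(t) vanishes at 0.
  have hmono : StrictMonoOn (fun t : ℝ => t ^ k * (F t).re) (Icc 0 γ) := by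
    refine strictMonoOn_of_deriv_pos (convex_Icc 0 γ) hcont.continuousOn fun s hs => ?_
    rw [interior_Icc] at hs
    have h1 : HasDerivAt (fun t : ℝ => t ^ k * (F t).re)
        (k * s ^ (k - 1) * (F s).re + s ^ k * (deriv F s).re) s :=
      (Real.hasDerivAt_rpow_const (.inl hs.1.ne')).mul (hF s).hasDerivAt.real_of_complex
    rw [h1.deriv]
    have h2 : k * s ^ (k - 1) * (F s).re + s ^ k * (deriv F s).re =
        k * s ^ (k - 1) * (eulerOp c F s).re := by
      have h3 : s ^ k = s ^ (k - 1) * s := by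
        rw [← Real.rpow_add_one hs.1.ne', sub_add_cancel]
      rw [eulerOp_re, h3, hk]
      field_simp
    rw [h2]
    have := h.re_pos s ⟨hs.1.le, hs.2⟩
    have := Real.rpow_pos_of_pos hs.1 (k - 1)
    positivity
  have h4 := hmono (left_mem_Icc.2 h.pos.le) ⟨ht.1.le, ht.2⟩ ht.1
  simp only [Real.zero_rpow hk0.ne', zero_mul] at h4
  exact (mul_pos_iff_of_pos_left (Real.rpow_pos_of_pos ht.1 k)).1 h4

/-- Critical points of `C (k z) ^ ν G ((k z) ^ 2)` on the positive axis. -/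
theorem deriv_cpow_mul_eq_zero_iff {J G : ℂ → ℂ} (hG : Differentiable ℂ G) {ν k : ℝ} (hν : 0 < ν)
    (hk : 0 < k) {C : ℂ} (hC : C ≠ 0)
    (hJ : ∀ z, z ≠ 0 → J z = C * (k * z) ^ (ν : ℂ) * G ((k * z) ^ 2)) {r : ℝ} (hr : 0 < r) :
    deriv J r = 0 ↔ eulerOp (2 / ν) G (((k * r) ^ 2 : ℝ) : ℂ) = 0 := by
  have hrc : (r : ℂ) ≠ 0 := by exact_mod_cast hr.ne'
  have hkc : (k : ℂ) ≠ 0 := by exact_mod_cast hk.ne'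
  have hνc : (ν : ℂ) ≠ 0 := by exact_mod_cast hν.ne'
  have hev : J =ᶠ[𝓝 (r : ℂ)] fun z => C * (k * z) ^ (ν : ℂ) * G ((k * z) ^ 2) := by
    filter_upwards [isOpen_ne.mem_nhds hrc] with z hz using hJ z hz
  have hlin : HasDerivAt (fun z : ℂ => (k : ℂ) * z) k (r : ℂ) := by
    simpa using (hasDerivAt_id (r : ℂ)).const_mul (k : ℂ)
  have hslit : (k : ℂ) * r ∈ Complex.slitPlane := by
    rw [← Complex.ofReal_mul]
    exact Complex.ofReal_mem_slitPlane.2 (mul_pos hk hr)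
  have h1 := hlin.cpow_const (c := (ν : ℂ)) hslit
  have h2 : HasDerivAt (fun z : ℂ => G (((k : ℂ) * z) ^ 2))
      (deriv G (((k : ℂ) * r) ^ 2) * (2 * ((k : ℂ) * r) * k)) (r : ℂ) := by
    have h3 := hlin.fun_pow 2
    have h4 := (hG (((k : ℂ) * r) ^ 2)).hasDerivAt.comp (r : ℂ) h3
    refine h4.congr_deriv ?_
    simp
  have h5 := (h1.const_mul C).fun_mul h2
  rw [hev.deriv_eq, h5.deriv]
  have hkr : (k : ℂ) * r ≠ 0 := mul_ne_zero hkc hrc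
  have h6 : ((k : ℂ) * r) ^ (ν : ℂ) = ((k : ℂ) * r) ^ ((ν : ℂ) - 1) * ((k : ℂ) * r) := by
    rw [Complex.cpow_sub _ _ hkr, Complex.cpow_one, div_mul_cancel₀ _ hkr]
  have h7 : C * ((ν : ℂ) * ((k : ℂ) * r) ^ ((ν : ℂ) - 1) * k) * G (((k : ℂ) * r) ^ 2) +
      C * ((k : ℂ) * r) ^ (ν : ℂ) * (deriv G (((k : ℂ) * r) ^ 2) * (2 * ((k : ℂ) * r) * k)) =
      (C * ν * k * ((k : ℂ) * r) ^ ((ν : ℂ) - 1)) *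
        eulerOp (2 / ν) G (((k * r) ^ 2 : ℝ) : ℂ) := by
    rw [h6, eulerOp]
    push_cast
    field_simp
  have h8 : C * ν * k * ((k : ℂ) * r) ^ ((ν : ℂ) - 1) ≠ 0 := by
    refine mul_ne_zero (mul_ne_zero (mul_ne_zero hC hνc) hkc) ?_
    rw [Complex.cpow_def_of_ne_zero hkr]
    exact Complex.exp_ne_zero _
  rw [h7, mul_eq_zero, or_iff_right h8]

/-! ### The radius of starlikeness -/

/-- On a disk where φ has no zero, φ'/φ has a primitive g, and integration along the ray gives g(z)
- g(0). -/
theorem hasDerivAt_radialLog {φ : ℂ → ℂ} (hφ : Differentiable ℂ φ) {R : ℝ}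
    (h : ∀ z ∈ Metric.ball (0 : ℂ) R, φ z ≠ 0) {z : ℂ} (hz : z ∈ Metric.ball (0 : ℂ) R) :
    HasDerivAt (radialLog φ) (deriv φ z / φ z) z := by
  have hd : Differentiable ℂ (deriv φ) := hφ.contDiff.differentiable_deriv_two
  have hquot : DifferentiableOn ℂ (fun z => deriv φ z / φ z) (Metric.ball 0 R) :=
    hd.differentiableOn.div hφ.differentiableOn h
  obtain ⟨g, hg⟩ := hquot.isExactOn_ball
  have heq : ∀ z ∈ Metric.ball (0 : ℂ) R, radialLog φ z = g z - g 0 := by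
    intro z hz
    have hmem : ∀ t ∈ uIcc (0 : ℝ) 1, (t : ℂ) * z ∈ Metric.ball (0 : ℂ) R := by
      intro t ht
      rw [uIcc_of_le zero_le_one] at ht
      rw [mem_ball_zero_iff] at hz ⊢
      rw [norm_mul, Complex.norm_real, Real.norm_of_nonneg ht.1]
      exact (mul_le_of_le_one_left (norm_nonneg z) ht.2).trans_lt hz
    have hline : Continuous fun t : ℝ => (t : ℂ) * z := by fun_prop
    have hderiv : ∀ t ∈ uIcc (0 : ℝ) 1, HasDerivAt (fun t : ℝ => g ((t : ℂ) * z))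
        (z * deriv φ ((t : ℂ) * z) / φ ((t : ℂ) * z)) t := by
      intro t ht
      have h1 : HasDerivAt (fun s : ℝ => (s : ℂ) * z) z t := by
        simpa using (Complex.ofRealCLM.hasDerivAt (x := t)).mul_const z
      refine ((hg _ (hmem t ht)).comp t h1).congr_deriv ?_
      ring
    rw [radialLog, intervalIntegral.integral_eq_sub_of_hasDerivAt hderiv]
    · simp
    · refine ContinuousOn.intervalIntegrable (ContinuousOn.div ?_ ?_ fun t ht => h _ (hmem t ht))
      · exact (continuous_const.mul (hd.continuous.comp hline)).continuousOn
      · exact (hφ.continuous.comp hline).continuousOn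
  have hev : radialLog φ =ᶠ[𝓝 z] fun z => g z - g 0 := by
    filter_upwards [Metric.isOpen_ball.mem_nhds hz] with w hw using heq w hw
  exact ((hg z hz).sub_const _).congr_of_eventuallyEq hev

/-- The radius of starlikeness of `z F(z ^ 2) ^ (1 / ν)` for a limit `F` of polynomials with
positive zeros. -/
theorem starlikeRadius_eq {F : ℂ → ℂ} (A : RootApprox F) {ν γ : ℝ} (hν : 0 < ν)
    (hγ : IsFirstZero (eulerOp (2 / ν) F) γ) :
    starlikeRadius (fun z => z * Complex.exp (radialLog (fun z => F (z ^ 2)) z / (ν : ℂ))) =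
      √γ := by
  have hF := A.differentiable
  have hc : 0 < 2 / ν := by positivity
  have hνc : (ν : ℂ) ≠ 0 := by exact_mod_cast hν.ne'
  have hcont : Continuous fun t : ℝ => (F t).re :=
    Complex.continuous_re.comp (hF.continuous.comp Complex.continuous_ofReal)
  have hpos : ∀ t ∈ Icc 0 γ, 0 < (F t).re := by
    intro t ht
    rcases ht.1.eq_or_lt with rfl | h
    · simp [A.map_zero]
    · exact hγ.re_pos_of_eulerOp hF hc ⟨h, ht.2⟩
  -- F is still positive at γ, hence slightly beyond. On the larger disk f is analytic and the
  -- formula for z f'/f holds at z = √γ itself, as maximality of the radius requires.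
  obtain ⟨δ, hδ, hδF⟩ := Metric.eventually_nhds_iff.1
    (hcont.continuousAt.eventually_const_lt (hpos γ (right_mem_Icc.2 hγ.pos.le)))
  have hposρ : ∀ t ∈ Ico 0 (γ + δ), 0 < (F t).re := by
    intro t ht
    rcases le_or_gt t γ with h | h
    · exact hpos t ⟨ht.1, h⟩
    · refine hδF ?_
      rw [Real.dist_eq, abs_of_pos (sub_pos.2 h)]
      linarith [ht.2]
  have hne : ∀ w : ℂ, ‖w‖ < γ + δ → F w ≠ 0 := by
    intro w hw
    have h1 := hposρ ‖w‖ ⟨norm_nonneg _, hw⟩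
    have h2 := A.re_le_norm le_rfl fun t ht => hposρ t ⟨ht.1, ht.2.trans_lt hw⟩
    exact norm_pos_iff.1 (h1.trans_le h2)
  have hφ : Differentiable ℂ fun z => F (z ^ 2) := hF.comp (differentiable_id.pow 2)
  have hφ' : ∀ z, deriv (fun z => F (z ^ 2)) z = deriv F (z ^ 2) * (2 * z) := by
    intro z
    have := (hF (z ^ 2)).hasDerivAt.comp z (hasDerivAt_pow 2 z)
    refine this.deriv.trans ?_
    simp
  have hsq : ∀ {z : ℂ} {s : ℝ}, 0 ≤ s → (‖z ^ 2‖ < s ↔ z ∈ Metric.ball (0 : ℂ) √s) := by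
    intro z s hs
    rw [mem_ball_zero_iff, norm_pow, Real.lt_sqrt (norm_nonneg z)]
  have hγδ : 0 ≤ γ + δ := by linarith [hγ.pos]
  set f : ℂ → ℂ := fun z => z * Complex.exp (radialLog (fun z => F (z ^ 2)) z / (ν : ℂ)) with hf
  have hfd : ∀ z ∈ Metric.ball (0 : ℂ) √(γ + δ), HasDerivAt f
      (Complex.exp (radialLog (fun z => F (z ^ 2)) z / (ν : ℂ)) *
        (eulerOp (2 / ν) F (z ^ 2) / F (z ^ 2))) z := by
    intro z hz
    have h1 := hasDerivAt_radialLog hφ (R := √(γ + δ))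
      (fun y hy => hne _ ((hsq hγδ).2 hy)) hz
    have h2 := (hasDerivAt_id z).mul (h1.div_const (ν : ℂ)).cexp
    refine h2.congr_deriv ?_
    have := hne _ ((hsq hγδ).2 hz)
    rw [hφ', eulerOp]
    simp only [id]
    push_cast
    field_simp
  have hquot : ∀ z ∈ Metric.ball (0 : ℂ) √(γ + δ), z ≠ 0 →
      z * deriv f z / f z = eulerOp (2 / ν) F (z ^ 2) / F (z ^ 2) := by
    intro z hz hz0
    rw [(hfd z hz).deriv, hf]
    have := Complex.exp_ne_zero (radialLog (fun z => F (z ^ 2)) z / (ν : ℂ))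
    field_simp
  have hsub : √γ < √(γ + δ) := Real.sqrt_lt_sqrt hγ.pos.le (by linarith)
  refine IsGreatest.csSup_eq ⟨⟨Real.sqrt_pos.2 hγ.pos, ?_, ?_⟩, ?_⟩
  · intro z hz
    exact (hfd z (Metric.ball_subset_ball hsub.le hz)).differentiableAt.differentiableWithinAt
  · intro z hz hz0
    rw [hquot z (Metric.ball_subset_ball hsub.le hz) hz0]
    set w := z ^ 2 with hw
    set r := ‖w‖ with hr
    have hrγ : r < γ := (hsq hγ.pos.le).2 hz
    have hwne : F w ≠ 0 := hne w (by linarith)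
    have hFr : 0 < (F r).re := hpos r ⟨norm_nonneg w, hrγ.le⟩
    have hE := hγ.re_pos r ⟨norm_nonneg w, hrγ⟩
    rw [eulerOp_re] at hE
    have h1 := A.norm_deriv_mul_le (r := r) le_rfl
      fun t ht => hpos t ⟨ht.1, ht.2.trans hrγ.le⟩
    have h2 : eulerOp (2 / ν) F w / F w = 1 + ((2 / ν : ℝ) : ℂ) * (w * deriv F w / F w) := by
      rw [eulerOp]
      field_simp
    rw [h2, Complex.add_re, Complex.one_re, Complex.re_ofReal_mul]
    have h3 : -(r * ‖deriv F w‖ / ‖F w‖) ≤ (w * deriv F w / F w).re := by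
      have := Complex.abs_re_le_norm (w * deriv F w / F w)
      rw [norm_div, norm_mul] at this
      exact (abs_le.1 this).1
    -- The worst point of the circle is w = r, where 1 + (2/ν) r F'(r)/F(r) is positive because r <
    -- γ.
    have h4 : r * ‖deriv F w‖ / ‖F w‖ ≤ r * (-(deriv F r).re) / (F r).re := by
      rw [div_le_div_iff₀ (norm_pos_iff.2 hwne) hFr, mul_assoc, mul_assoc]
      exact mul_le_mul_of_nonneg_left h1 (norm_nonneg w)
    have h5 : 2 / ν * (r * (-(deriv F r).re) / (F r).re) < 1 := by
      rw [mul_div_assoc', div_lt_one hFr]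
      linarith
    have h6 : 2 / ν * (-(r * (-(deriv F r).re) / (F r).re)) ≤
        2 / ν * (w * deriv F w / F w).re :=
      mul_le_mul_of_nonneg_left (by linarith) hc.le
    linarith
  -- In a disk of radius larger than √γ the point z = √γ is admissible, and z f'/f is 0 there.
  · rintro r ⟨-, -, hr⟩
    by_contra! hlt
    have hz0 : ((√γ : ℝ) : ℂ) ≠ 0 := by exact_mod_cast (Real.sqrt_pos.2 hγ.pos).ne'
    have hnorm : ‖((√γ : ℝ) : ℂ)‖ = √γ := by
      rw [Complex.norm_real, Real.norm_of_nonneg (Real.sqrt_nonneg _)]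
    have h1 := hr ((√γ : ℝ) : ℂ) (by rwa [mem_ball_zero_iff, hnorm]) hz0
    rw [hquot _ (by rwa [mem_ball_zero_iff, hnorm]) hz0, ← Complex.ofReal_pow,
      Real.sq_sqrt hγ.pos.le, hγ.zero] at h1
    simp at h1

/-! ### The Hahn-Exton function: series form, bounds and radius -/

theorem qPochInf_ne_zero {a q : ℝ} (ha : 0 < a) (ha1 : a < 1) (hq : 0 < q) (hq1 : q < 1) :
    qPochInf a q ≠ 0 := by
  have h : qPochInf a q = ∏' k : ℕ, (1 + -(a * q ^ k)) := by simp only [qPochInf, sub_eq_add_neg]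
  rw [h]
  refine tprod_one_add_ne_zero_of_summable (fun k => ?_) ?_
  · have h1 : q ^ k ≤ 1 := pow_le_one₀ hq.le hq1.le
    have h2 : 0 < q ^ k := pow_pos hq k
    nlinarith
  · refine ((summable_geometric_of_lt_one hq.le hq1).mul_left a).congr fun k => ?_
    rw [norm_neg, Real.norm_of_nonneg (by positivity)]

theorem cpow_two_mul_nat_add {z : ℂ} (hz : z ≠ 0) (n : ℕ) (ν : ℂ) :
    z ^ (2 * (n : ℂ) + ν) = z ^ ν * (z ^ 2) ^ n := by
  rw [Complex.cpow_add _ _ hz, mul_comm, ← pow_mul, ← Complex.cpow_natCast z (2 * n)]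
  push_cast
  rfl

theorem hahnExtonJ_eq {ν q : ℝ} {z : ℂ} (hz : z ≠ 0) :
    hahnExtonJ ν q z = ((qPochInf (q ^ (ν + 1)) q / qPochInf q q : ℝ) : ℂ) * z ^ (ν : ℂ) *
      altSeries (hahnCoeff ν q) (z ^ 2) := by
  rw [hahnExtonJ, mul_assoc]
  congr 1
  rw [altSeries, ← tsum_mul_left]
  refine tsum_congr fun n => ?_
  rw [cpow_two_mul_nat_add hz, hahnCoeff]
  push_cast
  ring

theorem hahnExtonPhi_eq {ν q : ℝ} (hν : 0 < ν) (hq : 0 < q) (hq1 : q < 1) :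
    hahnExtonPhi ν q = fun z => altSeries (hahnCoeff ν q) (z ^ 2) := by
  funext z
  rw [hahnExtonPhi]
  split_ifs with hz
  · rw [hz, zero_pow two_ne_zero]
    have := (entireCoeff_hahnCoeff hν hq hq1).iteratedDeriv_zero 0
    simpa [hahnCoeff_zero] using this.symm
  · have h1 := qPochInf_ne_zero hq hq1 hq hq1
    have h2 := qPochInf_ne_zero (Real.rpow_pos_of_pos hq (ν + 1))
      (Real.rpow_lt_one hq.le hq1 (by linarith)) hq hq1
    have h3 : z ^ (ν : ℂ) ≠ 0 := by
      rw [Complex.cpow_def_of_ne_zero hz]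
      exact Complex.exp_ne_zero _
    have h4 : ((hahnExtonC ν q : ℝ) : ℂ) *
        ((qPochInf (q ^ (ν + 1)) q / qPochInf q q : ℝ) : ℂ) = 1 := by
      rw [← Complex.ofReal_mul, hahnExtonC, div_mul_div_comm, mul_comm,
        div_self (mul_ne_zero h2 h1), Complex.ofReal_one]
    rw [hahnExtonJ_eq hz, ← mul_assoc, ← mul_assoc, h4, one_mul, mul_div_cancel_left₀ _ h3]

/-- The coefficients of `z J'(z)`, where `J` is the Hahn-Exton function, in `z ^ 2`. -/
noncomputable def hahnDerivCoeff (ν q : ℝ) (n : ℕ) : ℝ := (1 + 2 / ν * n) * hahnCoeff ν q n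

section

variable {ν q : ℝ}

theorem eulerOp_hahnCoeff (hν : 0 < ν) (hq : 0 < q) (hq1 : q < 1) :
    eulerOp (2 / ν) (altSeries (hahnCoeff ν q)) = altSeries (hahnDerivCoeff ν q) :=
  (entireCoeff_hahnCoeff hν hq hq1).eulerOp_eq (by positivity)

theorem entireCoeff_hahnDerivCoeff (hν : 0 < ν) (hq : 0 < q) (hq1 : q < 1) :
    EntireCoeff (hahnDerivCoeff ν q) :=
  (entireCoeff_hahnCoeff hν hq hq1).linear_mul (by positivity)

theorem posRootLimit_hahnDerivCoeff (hν : 0 < ν) (hq : 0 < q) (hq1 : q < 1) :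
    PosRootLimit (altSeries (hahnDerivCoeff ν q)) := by
  rw [← eulerOp_hahnCoeff hν hq hq1]
  exact (posRootLimit_hahnCoeff hν hq hq1).eulerOp (by positivity)

theorem hahnCoeff_one (hq : 0 < q) :
    hahnCoeff ν q 1 = q / ((1 - q) * (1 - q ^ (ν + 1))) := by
  have h := hahnCoeff_succ (ν := ν) hq 0
  simpa [hahnCoeff_zero] using h

theorem hahnCoeff_two (hq : 0 < q) :
    hahnCoeff ν q 2 = q / ((1 - q) * (1 - q ^ (ν + 1))) *
      (q ^ 2 / ((1 - q ^ 2) * (1 - q ^ (ν + 2)))) := by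
  have h := hahnCoeff_succ (ν := ν) hq 1
  rw [hahnCoeff_one hq] at h
  have h1 : ν + ((1 : ℕ) : ℝ) + 1 = ν + 2 := by push_cast; ring
  rw [h1] at h
  exact h

theorem hahnExtonLower_eq (hν : 0 < ν) (hq : 0 < q) :
    hahnExtonLower ν q = 1 / hahnDerivCoeff ν q 1 := by
  rw [hahnExtonLower, hahnDerivCoeff, hahnCoeff_one hq]
  push_cast
  field_simp

theorem hahnDerivCoeff_sq_sub_eq (hν : 0 < ν) (hq : 0 < q) (hq1 : q < 1) :
    hahnDerivCoeff ν q 1 ^ 2 - 2 * hahnDerivCoeff ν q 2 =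
      q ^ 2 * ((1 + q) * (1 - q ^ (ν + 2)) * (ν + 2) ^ 2
        - 2 * ν * (ν + 4) * q * (1 - q ^ (ν + 1))) /
      (ν ^ 2 * (1 - q) ^ 2 * (1 - q ^ (ν + 1)) ^ 2 * ((1 + q) * (1 - q ^ (ν + 2)))) := by
  have h1 := (one_sub_rpow_pos hq hq1 (s := ν + 1) (by linarith)).ne'
  have h2 := (one_sub_rpow_pos hq hq1 (s := ν + 2) (by linarith)).ne'
  have h3 : 1 - q ≠ 0 := (sub_pos.2 hq1).ne'
  have h4 : 1 + q ≠ 0 := by positivity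
  have h5 : 1 - q ^ 2 = (1 - q) * (1 + q) := by ring
  rw [hahnDerivCoeff, hahnDerivCoeff, hahnCoeff_one hq, hahnCoeff_two hq, h5]
  push_cast
  field_simp
  ring

/-- Since 1 - q^(ν+1) ≤ 1 - q^(ν+2), it suffices that 2 q ν (ν + 4) < (1 + q)(ν + 2)², which follows
from 2 q < 1 + q and (ν + 2)² = ν (ν + 4) + 4. -/
theorem hahnExtonUpper_denom_pos (hν : 0 < ν) (hq : 0 < q) (hq1 : q < 1) :
    0 < (1 + q) * (1 - q ^ (ν + 2)) * (ν + 2) ^ 2 - 2 * ν * (ν + 4) * q * (1 - q ^ (ν + 1)) := by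
  have h1 := one_sub_rpow_pos hq hq1 (s := ν + 1) (by linarith)
  have h2 : q ^ (ν + 2) ≤ q ^ (ν + 1) :=
    Real.rpow_le_rpow_of_exponent_ge hq hq1.le (by linarith)
  have h3 : 2 * ν * (ν + 4) * q * (1 - q ^ (ν + 1)) ≤
      2 * ν * (ν + 4) * q * (1 - q ^ (ν + 2)) := by gcongr
  have h4 : 2 * ν * (ν + 4) * q < (1 + q) * (ν + 2) ^ 2 := by
    have : 0 < ν * (ν + 4) := by positivity
    nlinarith
  have h5 : 0 < 1 - q ^ (ν + 2) := by linarith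
  nlinarith

theorem hahnDerivCoeff_sq_sub_pos (hν : 0 < ν) (hq : 0 < q) (hq1 : q < 1) :
    0 < hahnDerivCoeff ν q 1 ^ 2 - 2 * hahnDerivCoeff ν q 2 := by
  rw [hahnDerivCoeff_sq_sub_eq hν hq hq1]
  have h1 := one_sub_rpow_pos hq hq1 (s := ν + 1) (by linarith)
  have h2 := one_sub_rpow_pos hq hq1 (s := ν + 2) (by linarith)
  have h3 : 0 < 1 - q := sub_pos.2 hq1
  have h4 := hahnExtonUpper_denom_pos hν hq hq1
  positivity

theorem hahnExtonUpper_eq (hν : 0 < ν) (hq : 0 < q) (hq1 : q < 1) :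
    hahnExtonUpper ν q =
      hahnDerivCoeff ν q 1 / (hahnDerivCoeff ν q 1 ^ 2 - 2 * hahnDerivCoeff ν q 2) := by
  have h1 := (one_sub_rpow_pos hq hq1 (s := ν + 1) (by linarith)).ne'
  have h2 := (one_sub_rpow_pos hq hq1 (s := ν + 2) (by linarith)).ne'
  have h3 : 1 - q ≠ 0 := (sub_pos.2 hq1).ne'
  have h4 : 1 + q ≠ 0 := by positivity
  have h5 := (hahnExtonUpper_denom_pos hν hq hq1).ne'
  have h6 : 1 - q ^ 2 = (1 - q) * (1 + q) := by ring
  rw [hahnDerivCoeff_sq_sub_eq hν hq hq1, hahnExtonUpper, h6, hahnDerivCoeff, hahnCoeff_one hq]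
  generalize (1 + q) * (1 - q ^ (ν + 2)) * (ν + 2) ^ 2 -
    2 * ν * (ν + 4) * q * (1 - q ^ (ν + 1)) = D at h5 ⊢
  push_cast
  field_simp

theorem hahnDerivCoeff_pos (hν : 0 < ν) (hq : 0 < q) (hq1 : q < 1) (n : ℕ) :
    0 < hahnDerivCoeff ν q n :=
  mul_pos (by positivity) (hahnCoeff_pos hν hq hq1 n)

theorem hahnDerivCoeff_scaled_le (hν : 0 < ν) (hq : 0 < q) (hq1 : q < 1) (n : ℕ) :
    |hahnDerivCoeff ν q n * ((1 - q) ^ 2) ^ n| ≤ (1 + 2 / ν * n) * (1 / n.factorial) := by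
  have h3 : 0 < 1 - q := sub_pos.2 hq1
  rw [abs_of_pos (mul_pos (hahnDerivCoeff_pos hν hq hq1 n) (by positivity)), hahnDerivCoeff,
    mul_assoc]
  exact mul_le_mul_of_nonneg_left (hahnCoeff_mul_le hν hq hq1 n) (by positivity)

theorem exists_isFirstZero_hahnDerivCoeff (hν : 0 < ν) (hq : 0 < q) (hq1 : q < 1) :
    ∃ γ, IsFirstZero (altSeries (hahnDerivCoeff ν q)) γ ∧ hahnExtonLower ν q < γ ∧
      γ < hahnExtonUpper ν q := by
  rw [hahnExtonLower_eq hν hq, hahnExtonUpper_eq hν hq hq1]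
  exact exists_isFirstZero (entireCoeff_hahnDerivCoeff hν hq hq1) (hahnDerivCoeff_pos hν hq hq1)
    (posRootLimit_hahnDerivCoeff hν hq hq1) (hahnDerivCoeff_sq_sub_pos hν hq hq1)

theorem starlikeRadius_hahnExtonF (hν : 0 < ν) (hq : 0 < q) (hq1 : q < 1) {γ : ℝ}
    (hγ : IsFirstZero (altSeries (hahnDerivCoeff ν q)) γ) :
    starlikeRadius (hahnExtonF ν q) = √γ := by
  obtain ⟨A⟩ := (posRootLimit_hahnCoeff hν hq hq1).exists_approx
  rw [← eulerOp_hahnCoeff hν hq hq1] at hγ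
  rw [← starlikeRadius_eq A hν hγ]
  congr 1
  funext z
  rw [hahnExtonF, hahnExtonPhi_eq hν hq hq1]

/-- The first positive critical point of `C (k z) ^ ν F((k z) ^ 2)` in terms of the first zero. -/
theorem isLeast_of_isFirstZero {P : ℝ → Prop} {G : ℂ → ℂ} {k γ : ℝ} (hk : 0 < k)
    (hP : ∀ r, 0 < r → (P r ↔ G (((k * r) ^ 2 : ℝ) : ℂ) = 0)) (hγ : IsFirstZero G γ) :
    IsLeast {r : ℝ | 0 < r ∧ P r} (√γ / k) := by
  have h0 : 0 < √γ / k := div_pos (Real.sqrt_pos.2 hγ.pos) hk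
  refine ⟨⟨h0, (hP _ h0).2 ?_⟩, fun r hr => ?_⟩
  · rw [mul_div_cancel₀ _ hk.ne', Real.sq_sqrt hγ.pos.le]
    exact hγ.zero
  · have h1 := hγ.le (by positivity) ((hP r hr.1).1 hr.2)
    rw [div_le_iff₀ hk, mul_comm]
    exact (Real.sqrt_le_left (mul_pos hk hr.1).le).2 h1

theorem isLeast_hahnExtonJ (hν : 0 < ν) (hq : 0 < q) (hq1 : q < 1) {γ : ℝ}
    (hγ : IsFirstZero (altSeries (hahnDerivCoeff ν q)) γ) :
    IsLeast {r : ℝ | 0 < r ∧ (r : ℂ) * deriv (hahnExtonJ ν q) (r : ℂ) = 0} √γ := by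
  rw [← div_one √γ]
  refine isLeast_of_isFirstZero one_pos (fun r hr => ?_) hγ
  have hrc : (r : ℂ) ≠ 0 := by exact_mod_cast hr.ne'
  have h1 := qPochInf_ne_zero hq hq1 hq hq1
  have h2 := qPochInf_ne_zero (Real.rpow_pos_of_pos hq (ν + 1))
    (Real.rpow_lt_one hq.le hq1 (by linarith)) hq hq1
  rw [mul_eq_zero, or_iff_right hrc, ← eulerOp_hahnCoeff hν hq hq1]
  refine deriv_cpow_mul_eq_zero_iff (entireCoeff_hahnCoeff hν hq hq1).differentiable hν one_pos
    (Complex.ofReal_ne_zero.2 (div_ne_zero h2 h1)) (fun z hz => ?_) hr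
  rw [hahnExtonJ_eq hz, Complex.ofReal_one, one_mul]

end

/-! ### The limit q → 1 and the classical Bessel function -/

/-- The coefficients of `Γ(ν + 1) (z / 2) ^ (-ν) J_ν(z)` in `(z / 2) ^ 2`. -/
noncomputable def besselCoeff (ν : ℝ) (n : ℕ) : ℝ :=
  Real.Gamma (ν + 1) / (n.factorial * Real.Gamma (n + ν + 1))

/-- The coefficients of `z J_ν'(z)` in `(z / 2) ^ 2`, up to normalization. -/
noncomputable def besselDerivCoeff (ν : ℝ) (n : ℕ) : ℝ := (1 + 2 / ν * n) * besselCoeff ν n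

section

variable {ν : ℝ}

theorem besselCoeff_zero (hν : 0 < ν) : besselCoeff ν 0 = 1 := by
  have := (Real.Gamma_pos_of_pos (by linarith : 0 < ν + 1)).ne'
  simp [besselCoeff, this]

theorem besselCoeff_succ (hν : 0 < ν) (n : ℕ) :
    besselCoeff ν (n + 1) = besselCoeff ν n * (1 / ((n + 1) * (ν + n + 1))) := by
  have h1 : ((n + 1 : ℕ) : ℝ) + ν + 1 = (n + ν + 1) + 1 := by push_cast; ring
  have h2 : (n : ℝ) + ν + 1 ≠ 0 := by positivity
  rw [besselCoeff, besselCoeff, h1, Real.Gamma_add_one h2, Nat.factorial_succ, div_mul_div_comm,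
    mul_one]
  push_cast
  congr 1
  ring

theorem besselCoeff_pos (hν : 0 < ν) (n : ℕ) : 0 < besselCoeff ν n := by
  have h1 := Real.Gamma_pos_of_pos (by linarith : 0 < ν + 1)
  have h2 := Real.Gamma_pos_of_pos (by positivity : 0 < (n : ℝ) + ν + 1)
  rw [besselCoeff]
  positivity

theorem tendsto_one_sub_rpow_div {s : ℝ} :
    Tendsto (fun q : ℝ => (1 - q ^ s) / (1 - q)) (𝓝[<] 1) (𝓝 s) := by
  have h : HasDerivAt (fun q : ℝ => q ^ s) (s * 1 ^ (s - 1)) 1 :=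
    Real.hasDerivAt_rpow_const (.inl one_ne_zero)
  rw [Real.one_rpow, mul_one, hasDerivAt_iff_tendsto_slope] at h
  refine (h.mono_left (nhdsWithin_mono _ fun q hq => ne_of_lt hq)).congr fun q => ?_
  rw [slope_def_field, Real.one_rpow, ← neg_div_neg_eq, neg_sub, neg_sub]

theorem eventually_mem_Ioo : ∀ᶠ q : ℝ in 𝓝[<] 1, q ∈ Ioo (0 : ℝ) 1 :=
  Ioo_mem_nhdsLT one_pos

theorem tendsto_hahnCoeff (hν : 0 < ν) (n : ℕ) :
    Tendsto (fun q : ℝ => hahnCoeff ν q n * ((1 - q) ^ 2) ^ n) (𝓝[<] 1)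
      (𝓝 (besselCoeff ν n)) := by
  induction n with
  | zero => simp [hahnCoeff_zero, besselCoeff_zero hν]
  | succ n ih =>
    have h1 : Tendsto (fun q : ℝ => (1 - q ^ (n + 1)) / (1 - q)) (𝓝[<] 1) (𝓝 (n + 1)) := by
      have := tendsto_one_sub_rpow_div (s := ((n + 1 : ℕ) : ℝ))
      simp only [Real.rpow_natCast] at this
      exact_mod_cast this
    have h2 := tendsto_one_sub_rpow_div (s := ν + n + 1)
    have h3 : Tendsto (fun q : ℝ => q ^ (n + 1)) (𝓝[<] 1) (𝓝 1) := by
      have : ContinuousAt (fun q : ℝ => q ^ (n + 1)) 1 := by fun_prop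
      simpa using this.tendsto.mono_left nhdsWithin_le_nhds
    rw [besselCoeff_succ hν]
    refine (ih.mul (h3.div (h1.mul h2) (by positivity))).congr' ?_
    filter_upwards [eventually_mem_Ioo] with q hq
    have h4 : 1 - q ≠ 0 := (sub_pos.2 hq.2).ne'
    have h5 := (one_sub_pow_succ_pos hq.1 hq.2 n).ne'
    have h6 := (one_sub_rpow_pos hq.1 hq.2 (s := ν + n + 1) (by positivity)).ne'
    simp only [Pi.div_apply]
    rw [hahnCoeff_succ hq.1, pow_succ ((1 - q) ^ 2)]
    generalize ((1 - q) ^ 2) ^ n = P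
    field_simp

theorem tendsto_hahnDerivCoeff (hν : 0 < ν) (n : ℕ) :
    Tendsto (fun q : ℝ => hahnDerivCoeff ν q n * ((1 - q) ^ 2) ^ n) (𝓝[<] 1)
      (𝓝 (besselDerivCoeff ν n)) := by
  refine ((tendsto_hahnCoeff hν n).const_mul (1 + 2 / ν * n)).congr fun q => ?_
  rw [hahnDerivCoeff]
  ring

/-- Inherited from the q-uniform bound in the limit, so the same sequence dominates the family and
its limit. -/
theorem besselCoeff_le (hν : 0 < ν) (n : ℕ) : |besselCoeff ν n| ≤ 1 / n.factorial := by
  rw [abs_of_pos (besselCoeff_pos hν n)]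
  refine le_of_tendsto (tendsto_hahnCoeff hν n) ?_
  filter_upwards [eventually_mem_Ioo] with q hq using hahnCoeff_mul_le hν hq.1 hq.2 n

theorem entireCoeff_besselCoeff (hν : 0 < ν) : EntireCoeff (besselCoeff ν) :=
  entireCoeff_inv_factorial.of_le (besselCoeff_le hν)

theorem eulerOp_besselCoeff (hν : 0 < ν) :
    eulerOp (2 / ν) (altSeries (besselCoeff ν)) = altSeries (besselDerivCoeff ν) :=
  (entireCoeff_besselCoeff hν).eulerOp_eq (by positivity)

theorem besselDerivCoeff_one (hν : 0 < ν) :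
    besselDerivCoeff ν 1 = (ν + 2) / (ν * (ν + 1)) := by
  have h := besselCoeff_succ hν 0
  rw [besselDerivCoeff, h, besselCoeff_zero hν]
  push_cast
  field_simp
  ring

theorem besselDerivCoeff_sq_sub (hν : 0 < ν) :
    besselDerivCoeff ν 1 ^ 2 - 2 * besselDerivCoeff ν 2 =
      (ν ^ 2 + 8 * ν + 8) / (ν ^ 2 * (ν + 1) ^ 2 * (ν + 2)) := by
  have h := besselCoeff_succ hν 0
  have h' := besselCoeff_succ hν 1
  rw [h, besselCoeff_zero hν] at h'
  rw [besselDerivCoeff_one hν, besselDerivCoeff, h']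
  push_cast
  have h1 : ν + 1 + 1 ≠ 0 := by positivity
  have h2 : ν + 1 + 1 = ν + 2 := by ring
  rw [h2]
  field_simp
  ring

/-- The Hahn-Exton coefficients, scaled for the limit `q → 1`, extended by the limit. -/
noncomputable def scaledCoeff (ν q : ℝ) (n : ℕ) : ℝ :=
  if q ∈ Ioo (0 : ℝ) 1 then hahnDerivCoeff ν q n * ((1 - q) ^ 2) ^ n else besselDerivCoeff ν n

theorem entireCoeff_besselDerivCoeff (hν : 0 < ν) : EntireCoeff (besselDerivCoeff ν) :=
  (entireCoeff_besselCoeff hν).linear_mul (by positivity)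

/-- `tendsto_isFirstZero` asks for differentiability at every index, which is why the family is
defined for all real q. -/
theorem entireCoeff_scaledCoeff (hν : 0 < ν) (q : ℝ) : EntireCoeff (scaledCoeff ν q) := by
  by_cases hq : q ∈ Ioo (0 : ℝ) 1
  · have : scaledCoeff ν q = fun n => hahnDerivCoeff ν q n * ((1 - q) ^ 2) ^ n :=
      funext fun n => if_pos hq
    rw [this]
    exact (entireCoeff_hahnDerivCoeff hν hq.1 hq.2).scale (by positivity)
  · have : scaledCoeff ν q = besselDerivCoeff ν := funext fun n => if_neg hq
    rw [this]
    exact entireCoeff_besselDerivCoeff hν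

theorem altSeries_scaledCoeff {q : ℝ} (hq : q ∈ Ioo (0 : ℝ) 1) :
    altSeries (scaledCoeff ν q) =
      fun w => altSeries (hahnDerivCoeff ν q) (((1 - q) ^ 2 : ℝ) * w) := by
  funext w
  rw [altSeries_mul]
  congr 1
  exact funext fun n => if_pos hq

theorem tendstoLocallyUniformly_scaledCoeff (hν : 0 < ν) :
    TendstoLocallyUniformly (fun q => altSeries (scaledCoeff ν q))
      (altSeries (besselDerivCoeff ν)) (𝓝[<] 1) := by
  refine tendstoLocallyUniformly_altSeries
    (b := fun n => (1 + 2 / ν * n) * (1 / n.factorial))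
    (entireCoeff_inv_factorial.linear_mul (by positivity)) ?_ (fun n => ?_) (fun n => ?_)
  · filter_upwards [eventually_mem_Ioo] with q hq n
    rw [scaledCoeff, if_pos hq]
    exact hahnDerivCoeff_scaled_le hν hq.1 hq.2 n
  · rw [besselDerivCoeff, abs_mul, abs_of_pos (by positivity : 0 < 1 + 2 / ν * (n : ℝ))]
    exact mul_le_mul_of_nonneg_left (besselCoeff_le hν n) (by positivity)
  · refine (tendsto_hahnDerivCoeff hν n).congr' ?_
    filter_upwards [eventually_mem_Ioo] with q hq
    rw [scaledCoeff, if_pos hq]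

theorem eventually_posRootLimit_scaledCoeff (hν : 0 < ν) :
    ∀ᶠ q in 𝓝[<] (1 : ℝ), PosRootLimit (altSeries (scaledCoeff ν q)) := by
  filter_upwards [eventually_mem_Ioo] with q hq
  rw [altSeries_scaledCoeff hq]
  exact (posRootLimit_hahnDerivCoeff hν hq.1 hq.2).scale (pow_pos (sub_pos.2 hq.2) 2)

/-- Positivity of the zeros on the Bessel side needs no separate proof: it is inherited as q → 1
from the scaled Hahn-Exton series. -/
theorem exists_isFirstZero_besselDerivCoeff (hν : 0 < ν) :
    ∃ γ, IsFirstZero (altSeries (besselDerivCoeff ν)) γ ∧ 1 / besselDerivCoeff ν 1 < γ ∧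
      γ < besselDerivCoeff ν 1 / (besselDerivCoeff ν 1 ^ 2 - 2 * besselDerivCoeff ν 2) := by
  refine exists_isFirstZero (entireCoeff_besselDerivCoeff hν)
    (fun n => mul_pos (by positivity) (besselCoeff_pos hν n))
    (posRootLimit_of_tendsto (eventually_posRootLimit_scaledCoeff hν)
      (tendstoLocallyUniformly_scaledCoeff hν)) ?_
  rw [besselDerivCoeff_sq_sub hν]
  positivity

theorem besselJ_eq (hν : 0 < ν) {z : ℂ} (hz : z ≠ 0) :
    besselJ ν z = ((Real.Gamma (ν + 1))⁻¹ : ℝ) * (((1 / 2 : ℝ) : ℂ) * z) ^ (ν : ℂ) *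
      altSeries (besselCoeff ν) ((((1 / 2 : ℝ) : ℂ) * z) ^ 2) := by
  have h1 : ((1 / 2 : ℝ) : ℂ) * z = z / 2 := by push_cast; ring
  have h2 : z / 2 ≠ 0 := div_ne_zero hz two_ne_zero
  have h3 : (Real.Gamma (ν + 1) : ℂ) ≠ 0 := by
    exact_mod_cast (Real.Gamma_pos_of_pos (by linarith : 0 < ν + 1)).ne'
  rw [h1, besselJ, altSeries, ← tsum_mul_left]
  refine tsum_congr fun n => ?_
  rw [cpow_two_mul_nat_add h2, besselCoeff]
  push_cast
  field_simp

theorem isLeast_besselJ (hν : 0 < ν) {γ : ℝ}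
    (hγ : IsFirstZero (altSeries (besselDerivCoeff ν)) γ) :
    IsLeast {r : ℝ | 0 < r ∧ deriv (besselJ ν) (r : ℂ) = 0} (√γ / (1 / 2)) := by
  refine isLeast_of_isFirstZero (by norm_num) (fun r hr => ?_) hγ
  rw [← eulerOp_besselCoeff hν]
  refine deriv_cpow_mul_eq_zero_iff (entireCoeff_besselCoeff hν).differentiable hν (by norm_num)
    (Complex.ofReal_ne_zero.2 ?_) (fun z hz => besselJ_eq hν hz) hr
  exact inv_ne_zero (Real.Gamma_pos_of_pos (by linarith)).ne'

theorem tendsto_hahnExtonLower (hν : 0 < ν) :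
    Tendsto (fun q : ℝ => hahnExtonLower ν q / (1 - q) ^ 2) (𝓝[<] 1)
      (𝓝 (1 / besselDerivCoeff ν 1)) := by
  have h1 : besselDerivCoeff ν 1 ≠ 0 := by
    rw [besselDerivCoeff_one hν]
    positivity
  refine ((tendsto_const_nhds (x := (1 : ℝ))).div (tendsto_hahnDerivCoeff hν 1) h1).congr' ?_
  filter_upwards [eventually_mem_Ioo] with q hq
  simp only [Pi.div_apply]
  rw [hahnExtonLower_eq hν hq.1, pow_one, div_div]

theorem tendsto_hahnExtonUpper (hν : 0 < ν) :
    Tendsto (fun q : ℝ => hahnExtonUpper ν q / (1 - q) ^ 2) (𝓝[<] 1)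
      (𝓝 (besselDerivCoeff ν 1 /
        (besselDerivCoeff ν 1 ^ 2 - 2 * besselDerivCoeff ν 2))) := by
  have h1 : besselDerivCoeff ν 1 ^ 2 - 2 * besselDerivCoeff ν 2 ≠ 0 := by
    rw [besselDerivCoeff_sq_sub hν]
    positivity
  refine ((tendsto_hahnDerivCoeff hν 1).div (((tendsto_hahnDerivCoeff hν 1).pow 2).sub
    ((tendsto_hahnDerivCoeff hν 2).const_mul 2)) h1).congr' ?_
  filter_upwards [eventually_mem_Ioo] with q hq
  have h2 := (hahnDerivCoeff_sq_sub_pos hν hq.1 hq.2).ne'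
  have h3 : (1 - q) ^ 2 ≠ 0 := (pow_pos (sub_pos.2 hq.2) 2).ne'
  rw [hahnExtonUpper_eq hν hq.1 hq.2]
  simp only [Pi.div_apply]
  generalize (1 - q) ^ 2 = s at h3 ⊢
  have h4 : (hahnDerivCoeff ν q 1 * s ^ 1) ^ 2 - 2 * (hahnDerivCoeff ν q 2 * s ^ 2) =
      (hahnDerivCoeff ν q 1 ^ 2 - 2 * hahnDerivCoeff ν q 2) * s ^ 2 := by ring
  rw [h4]
  field_simp

end

/-! ### The main theorem -/

theorem theorem4 (ν : ℝ) (hν : 0 < ν) :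
    (∀ q : ℝ, 0 < q → q < 1 →
      IsLeast {r : ℝ | 0 < r ∧ (r : ℂ) * deriv (hahnExtonJ ν q) (r : ℂ) = 0}
        (starlikeRadius (hahnExtonF ν q)) ∧
      hahnExtonLower ν q < starlikeRadius (hahnExtonF ν q) ^ 2 ∧
      starlikeRadius (hahnExtonF ν q) ^ 2 < hahnExtonUpper ν q) ∧
    Tendsto (fun q : ℝ => hahnExtonLower ν q / (1 - q) ^ 2) (𝓝[<] 1)
      (𝓝 (ν * (ν + 1) / (ν + 2))) ∧
    Tendsto (fun q : ℝ => hahnExtonUpper ν q / (1 - q) ^ 2) (𝓝[<] 1)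
      (𝓝 (ν * (ν + 1) * (ν + 2) ^ 2 / (ν ^ 2 + 8 * ν + 8))) ∧
    ∃ j : ℝ, IsLeast {r : ℝ | 0 < r ∧ deriv (besselJ ν) (r : ℂ) = 0} j ∧
      Tendsto (fun q : ℝ => starlikeRadius (hahnExtonF ν q) ^ 2 / (1 - q) ^ 2) (𝓝[<] 1)
        (𝓝 (j ^ 2 / 4)) ∧
      4 * ν * (ν + 1) / (ν + 2) < j ^ 2 ∧
      j ^ 2 < 4 * ν * (ν + 1) * (ν + 2) ^ 2 / (ν ^ 2 + 8 * ν + 8) := by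
  have hlow : 1 / besselDerivCoeff ν 1 = ν * (ν + 1) / (ν + 2) := by
    rw [besselDerivCoeff_one hν, one_div_div]
  have hupp : besselDerivCoeff ν 1 / (besselDerivCoeff ν 1 ^ 2 - 2 * besselDerivCoeff ν 2) =
      ν * (ν + 1) * (ν + 2) ^ 2 / (ν ^ 2 + 8 * ν + 8) := by
    rw [besselDerivCoeff_sq_sub hν, besselDerivCoeff_one hν]
    field_simp
  obtain ⟨γ, hγ, hγ1, hγ2⟩ := exists_isFirstZero_besselDerivCoeff hν
  rw [hlow] at hγ1
  rw [hupp] at hγ2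
  -- The Bessel series is in the variable (z/2)², so the smallest critical point is j = 2 √γ.
  have hj : (√γ / (1 / 2)) ^ 2 = 4 * γ := by
    rw [div_pow, Real.sq_sqrt hγ.pos.le]
    ring
  refine ⟨fun q hq hq1 => ?_, hlow ▸ tendsto_hahnExtonLower hν, hupp ▸ tendsto_hahnExtonUpper hν,
    √γ / (1 / 2), isLeast_besselJ hν hγ, ?_, ?_, ?_⟩
  · obtain ⟨g, hg, hg1, hg2⟩ := exists_isFirstZero_hahnDerivCoeff hν hq hq1
    rw [starlikeRadius_hahnExtonF hν hq hq1 hg, Real.sq_sqrt hg.pos.le]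
    exact ⟨isLeast_hahnExtonJ hν hq hq1 hg, hg1, hg2⟩
  · rw [hj, mul_div_cancel_left₀ _ (four_ne_zero' ℝ)]
    -- Scaling the variable by (1 - q)² turns the smallest zero, the squared radius, into the
    -- squared radius divided by (1 - q)².
    refine tendsto_isFirstZero (tendstoLocallyUniformly_scaledCoeff hν)
      (fun q => (entireCoeff_scaledCoeff hν q).differentiable)
      (eventually_posRootLimit_scaledCoeff hν) ?_ hγ
    filter_upwards [eventually_mem_Ioo] with q hq
    obtain ⟨g, hg, -, -⟩ := exists_isFirstZero_hahnDerivCoeff hν hq.1 hq.2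
    rw [starlikeRadius_hahnExtonF hν hq.1 hq.2 hg, Real.sq_sqrt hg.pos.le,
      altSeries_scaledCoeff hq]
    exact hg.scale (pow_pos (sub_pos.2 hq.2) 2)
  · rw [hj]
    calc 4 * ν * (ν + 1) / (ν + 2) = 4 * (ν * (ν + 1) / (ν + 2)) := by ring
      _ < 4 * γ := by linarith
  · rw [hj]
    calc 4 * γ < 4 * (ν * (ν + 1) * (ν + 2) ^ 2 / (ν ^ 2 + 8 * ν + 8)) := by linarith
      _ = _ := by ring
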